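/- Let $p \ge 1$ and $n - p - 1 > 0$. For $M \in \mathbb{R}^{n\times p}$ and $N \ge 1$ let $Y \sim \mathrm{N}_{n,p}(M, I_n, N^{-1} I_p)$, i.e. the entries $Y_{ai} \sim \mathrm{N}(M_{ai}, 1/N)$ are independent, with density $p(Y \mid M)$; let $\mathrm{E}_M$ denote expectation under this law. Let $$\pi_{\mathrm{SVS}}(M) = \det(M^\top M)^{-(n-p-1)/2}, \qquad \pi_{\mathrm{MSVS2}}(M) = \pi_{\mathrm{SVS}}(M) \prod_{i=1}^p \| M_{\cdot i} \|^{-\gamma_i},$$ where $\|M_{\cdot i}\|$ is the Euclidean norm of the $i$-th column of $M$ and $0 \le \gamma_i \le p$ for every $i$. Let $$\hat M_\pi(Y) = \frac{\int \theta\, p(Y \mid \theta)\, \pi(\theta)\, \mathrm{d}\theta}{\int p(Y \mid \theta)\, \pi(\theta)\, \mathrm{d}\theta}$$ be the generalized Bayes estimator under the Frobenius loss with respect to the prior density $\pi$, and write $\hat M_{\mathrm{SVS}}$, $\hat M_{\mathrm{MSVS2}}$ for the two priors above. For every $N \ge 1$, both estimators are well defined for every $Y$ and have finite Frobenius risk at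 every $M$. Moreover, for every $M$ of full column rank $p$, $$N^2 \left( \mathrm{E}_M \| \hat M_{\mathrm{MSVS2}} - M \|_{\mathrm F}^2 - \mathrm{E}_M \| \hat M_{\mathrm{SVS}} - M \|_{\mathrm F}^2 \right) \to \sum_{i=1}^p \gamma_i (\gamma_i - 2p + 2) \| M_{\cdot i} \|^{-2} \qquad (N \to \infty).$$ Consequently, if $p \ge 2$ and $0 < \gamma_i \le p$ for every $i$, and it is not the case that $p = 2$ and $\gamma_1 = \gamma_2 = 2$, then $\hat M_{\mathrm{MSVS2}}$ asymptotically dominates $\hat M_{\mathrm{SVS}}$ under the Frobenius loss: at every $M$ of full column rank, the limit as $N\to\infty$ of $N^2$ times the risk difference is strictly negative. -/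

import Mathlib

open MeasureTheory ProbabilityTheory Filter Topology

namespace ShrinkagePriors

/-- Real `n × p` matrices, with the product Borel structure and Lebesgue measure
(Mathlib puts no measurable structure on `Matrix`). -/
abbrev Mat (n p : ℕ) : Type := Fin n → Fin p → ℝ

/-- The Euclidean norm `‖M_{·i}‖` of the `i`-th column. -/
noncomputable def colNorm {n p : ℕ} (M : Mat n p) (i : Fin p) : ℝ :=
  ‖WithLp.toLp 2 (fun a : Fin n => M a i)‖

/-- The Frobenius loss `‖A - M‖_F ^ 2`. -/
def frobLoss {n p : ℕ} (M A : Mat n p) : ℝ :=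
  ∑ a, ∑ i, (A a i - M a i) ^ 2

/-- The law of `Y ~ N_{n,p}(M, I_n, N⁻¹ I_p)`: independent entries `Y_{ai} ~ N(M_{ai}, 1/N)`. -/
noncomputable def obsLaw {n p : ℕ} (N : ℕ) (M : Mat n p) : Measure (Mat n p) :=
  Measure.pi fun a => Measure.pi fun i => gaussianReal (M a i) ((N : NNReal)⁻¹)

/-- The density `p(Y | M)` of `N_{n,p}(M, I_n, N⁻¹ I_p)` at `Y`. -/
noncomputable def lik {n p : ℕ} (N : ℕ) (M Y : Mat n p) : ℝ :=
  ∏ a, ∏ i, gaussianPDFReal (M a i) ((N : NNReal)⁻¹) (Y a i)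

/-- The prior `π_SVS(M) = det(Mᵀ M) ^ (-(n-p-1)/2)`. -/
noncomputable def priorSVS {n p : ℕ} (M : Mat n p) : ℝ :=
  ((Matrix.of M).transpose * Matrix.of M).det ^ (-(((n : ℝ) - p - 1) / 2))

/-- The prior `π_MSVS2(M) = π_SVS(M) ∏ᵢ ‖M_{·i}‖ ^ (-γᵢ)`. -/
noncomputable def priorMSVS2 {n p : ℕ} (γ : Fin p → ℝ) (M : Mat n p) : ℝ :=
  priorSVS M * ∏ i, colNorm M i ^ (-(γ i))

/-- The marginal density `m_π(Y) = ∫ p(Y | θ) π(θ) dθ`. -/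
noncomputable def marginal {n p : ℕ} (prior : Mat n p → ℝ) (N : ℕ) (Y : Mat n p) : ℝ :=
  ∫ θ : Mat n p, lik N θ Y * prior θ

/-- The generalized Bayes estimator under the Frobenius loss: the posterior mean of `θ` given `Y`
for the (improper) prior density `prior`. -/
noncomputable def genBayes {n p : ℕ} (prior : Mat n p → ℝ) (N : ℕ) (Y : Mat n p) : Mat n p :=
  fun a i => (∫ θ : Mat n p, θ a i * (lik N θ Y * prior θ)) / marginal prior N Y

/-- The posterior density is proper and has a mean for every observation `Y`, so that the
integrals in `genBayes` converge and its denominator is positive. -/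
def PosteriorMeanExists {n p : ℕ} (prior : Mat n p → ℝ) (N : ℕ) : Prop :=
  ∀ Y : Mat n p, Integrable (fun θ : Mat n p => lik N θ Y * prior θ) ∧
    0 < marginal prior N Y ∧
    ∀ a i, Integrable (fun θ : Mat n p => θ a i * (lik N θ Y * prior θ))

/-- The Frobenius loss of the estimator `δ` is integrable under `E_M`. -/
def FiniteRisk {n p : ℕ} (N : ℕ) (δ : Mat n p → Mat n p) (M : Mat n p) : Prop :=
  Integrable (fun Y => frobLoss M (δ Y)) (obsLaw N M)

/-- The Frobenius risk `E_M ‖δ(Y) - M‖_F ^ 2`. -/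
noncomputable def risk {n p : ℕ} (N : ℕ) (δ : Mat n p → Mat n p) (M : Mat n p) : ℝ :=
  ∫ Y, frobLoss M (δ Y) ∂(obsLaw N M)

/-- The sequence `N² (R_N(δ, M) - R_N(δ', M))` of scaled risk differences. -/
noncomputable def scaledRiskDiff {n p : ℕ} (δ δ' : ℕ → Mat n p → Mat n p) (M : Mat n p)
    (N : ℕ) : ℝ :=
  (N : ℝ) ^ 2 * (risk N (δ N) M - risk N (δ' N) M)

/-- `δ` asymptotically dominates `δ'` on the parameter set `Θ` under the Frobenius loss: at every
`M ∈ Θ` the scaled risk difference has a strictly negative limit (so the risk of `δ` is strictly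
smaller for all large `N`). -/
def AsymptoticallyDominates {n p : ℕ} (δ δ' : ℕ → Mat n p → Mat n p) (Θ : Set (Mat n p)) : Prop :=
  ∀ M ∈ Θ, ∃ L : ℝ, L < 0 ∧ Tendsto (scaledRiskDiff δ δ' M) atTop (𝓝 L)

/-- The matrices of full column rank. -/
def fullRank (n p : ℕ) : Set (Mat n p) := {M | (Matrix.of M).rank = p}

end ShrinkagePriors

open ShrinkagePriors

/-!
The posterior mean satisfies Tweedie's formula `δ_π(Y) = Y + N⁻¹ s_N(Y)` (`TamePrior.genBayes_eq`),
where the score `s_N = ∇ log m_π` can be written without derivatives as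
`√N E[Z π(Y + Z/√N)] / E[π(Y + Z/√N)]`, with `Z` a matrix of independent standard normal entries.
Expanding the squared loss gives

`N² (R_N(δ_π, M) - np/N) = 2 E[⟨Z, √N (s_N(M + Z/√N) - s_N(M))⟩] + E ‖s_N(M + Z/√N)‖²`,

and as `s_N → ∇ log π` near `M` with its first derivatives, the right-hand side tends to
`2 Δ log π + ‖∇ log π‖²` at `M` (`riskLimit`, `TamePrior.tendsto_sq_mul_risk_sub`).

The limit is justified for the class `TamePrior` of priors whose Gaussian averages are bounded
uniformly in the centre and which have a polynomial lower bound almost everywhere. These properties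
make all the integrals converge and the score polynomially bounded in `N` and `Y`. Near a point
where `π` is positive and `C²`, replacing `π` by a compactly supported `C²` function that agrees
with it near the point costs an exponentially small error; Stein's identity moves the factor `Z`
onto the derivatives of that function, and the expansion of the score at the scale `1/√N` follows
(`TamePrior.exists_expandsAt_score`). Where `M + Z/√N` is far from `M`, powers of `N` are bounded
by powers of `‖Z‖`, so dominated convergence applies.

Both priors are tame (`tamePrior_priorMSVS2`, of which `π_SVS` is the case `γ = 0`). The Gram
determinant is that of all columns but one times the squared distance of that column `x` from the
span `V` of the others, so the columns can be integrated out one at a time. In an orthonormal basis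
adapted to `V`, the singular factor `‖x‖^{-γ} dist(x, V)^{-(n-p-1)}` is at most a product
`∏ⱼ |xⱼ|^{-βⱼ}` with all `βⱼ < 1`, precisely because `γ < p + 1`; this bound does not depend on
`V` (`exists_lintegral_column_le`).

The difference of the two limits is computed for `π_MSVS2 = π_SVS u`, with
`u = ∏ᵢ ‖M_{·i}‖^{-γᵢ}`. The gradient of `log u` is radial in each column, so the cross term
`2 ⟨∇ log π_SVS, ∇ log u⟩` follows from Euler's relation for `π_SVS`, homogeneous of degree
`-(n - p - 1)` in each column, and the total is `∑ᵢ γᵢ (γᵢ - 2p + 2) / ‖M_{·i}‖²`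
(`riskLimit_priorMSVS2`). Finally `γᵢ - 2p + 2 ≤ 2 - p ≤ 0`, where equality forces `p = 2` and
`γᵢ = 2`.
-/

namespace ShrinkagePriors

variable {n p : ℕ}

/-! ### Gaussian product measures -/

lemma lintegral_fin_prod {α : Type*} [MeasurableSpace α] {m : ℕ} (μ : Fin m → Measure α)
    [∀ i, SigmaFinite (μ i)] {f : Fin m → α → ENNReal} (hf : ∀ i, Measurable (f i)) :
    ∫⁻ x, ∏ i, f i (x i) ∂(Measure.pi μ) = ∏ i, ∫⁻ t, f i t ∂(μ i) := by
  induction m with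
  | zero => simp
  | succ m ih =>
    have hmp := (measurePreserving_piFinSuccAbove μ 0).symm
    rw [← hmp.lintegral_comp (f := fun x => ∏ i, f i (x i)) (Finset.measurable_prod _ fun i _ =>
        (hf _).comp (measurable_pi_apply i))]
    simp_rw [MeasurableEquiv.piFinSuccAbove_symm_apply, Fin.insertNthEquiv,
      Fin.prod_univ_succ, Fin.insertNth_zero]
    simp only [Fin.zero_succAbove, Equiv.coe_fn_mk, Fin.cons_succ, Fin.cons_zero, cast_eq]
    rw [lintegral_prod_mul (f := f 0) (g := fun x : Fin m → α => ∏ i, f i.succ (x i))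
      (hf 0).aemeasurable (Finset.measurable_prod _ fun i _ =>
        (hf _).comp (measurable_pi_apply i)).aemeasurable]
    rw [ih (fun i => μ i.succ) (f := fun i => f i.succ) (fun i => hf _)]

lemma pi_withDensity {α : Type*} [MeasurableSpace α] {m : ℕ} (μ : Measure α) [SigmaFinite μ]
    {f : Fin m → α → ENNReal} (hf : ∀ i, Measurable (f i))
    [∀ i, SigmaFinite (μ.withDensity (f i))] :
    Measure.pi (fun i => μ.withDensity (f i)) =
      (Measure.pi fun _ : Fin m => μ).withDensity fun x => ∏ i, f i (x i) := by
  refine Measure.pi_eq fun s hs => ?_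
  rw [withDensity_apply _ (.univ_pi hs), ← lintegral_indicator (.univ_pi hs)]
  have : (Set.univ.pi s).indicator (fun x : Fin m → α => ∏ i, f i (x i)) =
      fun x => ∏ i, (s i).indicator (f i) (x i) := by
    classical
    ext x
    by_cases hx : x ∈ Set.univ.pi s
    · rw [Set.indicator_of_mem hx]
      exact Finset.prod_congr rfl fun i _ => (Set.indicator_of_mem (hx i trivial) _).symm
    · rw [Set.indicator_of_notMem hx]
      obtain ⟨i, hi⟩ : ∃ i, x i ∉ s i := by simpa [Set.mem_pi] using hx
      exact (Finset.prod_eq_zero (Finset.mem_univ i) (Set.indicator_of_notMem hi _)).symm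
  rw [this, lintegral_fin_prod _ fun i => (hf i).indicator (hs i)]
  refine Finset.prod_congr rfl fun i _ => ?_
  rw [withDensity_apply _ (hs i), lintegral_indicator (hs i)]

/-- The law of a matrix with independent standard normal entries. -/
noncomputable def stdLaw (n p : ℕ) : Measure (Mat n p) := obsLaw 1 0

instance isProbabilityMeasure_obsLaw (N : ℕ) (M : Mat n p) :
    IsProbabilityMeasure (obsLaw N M) := by
  unfold obsLaw; infer_instance

instance isProbabilityMeasure_stdLaw : IsProbabilityMeasure (stdLaw n p) := by
  unfold stdLaw; infer_instance

lemma lik_eq (N : ℕ) (θ Y : Mat n p) :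
    lik N θ Y = (√(2 * Real.pi * (N : ℝ)⁻¹))⁻¹ ^ (n * p) *
      Real.exp (-(N * frobLoss θ Y) / 2) := by
  unfold lik frobLoss
  simp_rw [gaussianPDFReal_def, Finset.prod_mul_distrib, ← Real.exp_sum]
  congr 1
  · simp [pow_mul, pow_right_comm _ p n]
  · congr 1
    rw [Finset.mul_sum, ← Finset.sum_neg_distrib, Finset.sum_div]
    refine Finset.sum_congr rfl fun a _ => ?_
    rw [Finset.mul_sum, ← Finset.sum_neg_distrib, Finset.sum_div]
    refine Finset.sum_congr rfl fun i _ => ?_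
    simp only [NNReal.coe_inv, NNReal.coe_natCast]
    by_cases h : (N : ℝ) = 0
    · simp [h]
    · field_simp

lemma frobLoss_comm (M A : Mat n p) : frobLoss M A = frobLoss A M := by
  unfold frobLoss
  exact Finset.sum_congr rfl fun a _ => Finset.sum_congr rfl fun i _ => by ring

lemma frobLoss_nonneg (M A : Mat n p) : 0 ≤ frobLoss M A := by
  unfold frobLoss; positivity

lemma lik_comm (N : ℕ) (θ Y : Mat n p) : lik N θ Y = lik N Y θ := by
  rw [lik_eq, lik_eq, frobLoss_comm]

lemma lik_nonneg (N : ℕ) (θ Y : Mat n p) : 0 ≤ lik N θ Y := by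
  rw [lik_eq]; positivity

lemma continuous_frobLoss : Continuous fun q : Mat n p × Mat n p => frobLoss q.1 q.2 := by
  unfold frobLoss; fun_prop

lemma continuous_lik (N : ℕ) : Continuous fun q : Mat n p × Mat n p => lik N q.1 q.2 := by
  simp_rw [lik_eq]
  have := continuous_frobLoss (n := n) (p := p)
  fun_prop

lemma measurable_lik (N : ℕ) (Y : Mat n p) : Measurable fun θ : Mat n p => lik N θ Y :=
  ((continuous_lik N).comp (by fun_prop : Continuous fun θ : Mat n p => (θ, Y))).measurable

/-- The likelihood is symmetric in parameter and observation, so that `θ ↦ p(Y ∣ θ)` is itself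
the density of a normal law, centred at `Y`. -/
lemma obsLaw_eq_withDensity {N : ℕ} (hN : 1 ≤ N) (Y : Mat n p) :
    obsLaw N Y = volume.withDensity fun θ : Mat n p => ENNReal.ofReal (lik N θ Y) := by
  have hv : ((N : NNReal)⁻¹) ≠ 0 := by simp; omega
  unfold obsLaw
  have h1 : ∀ a : Fin n, Measure.pi (fun i => gaussianReal (Y a i) ((N : NNReal)⁻¹)) =
      (volume : Measure (Fin p → ℝ)).withDensity
        (fun x => ∏ i, gaussianPDF (Y a i) ((N : NNReal)⁻¹) (x i)) := fun a => by
    simp_rw [gaussianReal_of_var_ne_zero _ hv]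
    have : ∀ i, SigmaFinite (volume.withDensity (gaussianPDF (Y a i) ((N : NNReal)⁻¹))) :=
      fun i => by rw [← gaussianReal_of_var_ne_zero _ hv]; infer_instance
    exact pi_withDensity volume fun i => measurable_gaussianPDF _ _
  have : ∀ a : Fin n, SigmaFinite ((volume : Measure (Fin p → ℝ)).withDensity
        (fun x => ∏ i, gaussianPDF (Y a i) ((N : NNReal)⁻¹) (x i))) :=
      fun i => by rw [← h1]; infer_instance
  simp_rw [h1]
  rw [pi_withDensity (f := fun a (x : Fin p → ℝ) =>
    ∏ i, gaussianPDF (Y a i) ((N : NNReal)⁻¹) (x i)) volume fun a =>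
      Finset.measurable_prod _ fun i _ =>
        (measurable_gaussianPDF _ _).comp (measurable_pi_apply i)]
  change (volume : Measure (Mat n p)).withDensity _ = _
  congr 1
  ext θ
  rw [lik_comm]
  unfold lik gaussianPDF
  rw [ENNReal.ofReal_prod_of_nonneg fun a _ =>
    Finset.prod_nonneg fun i _ => gaussianPDFReal_nonneg _ _ _]
  refine Finset.prod_congr rfl fun a _ => ?_
  rw [ENNReal.ofReal_prod_of_nonneg fun i _ => gaussianPDFReal_nonneg _ _ _]

lemma integral_obsLaw {N : ℕ} (hN : 1 ≤ N) (Y : Mat n p) (F : Mat n p → ℝ) :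
    ∫ θ, F θ ∂(obsLaw N Y) = ∫ θ, lik N θ Y * F θ := by
  rw [obsLaw_eq_withDensity hN, integral_withDensity_eq_integral_toReal_smul
    (measurable_lik N Y).ennreal_ofReal (by simp)]
  simp [ENNReal.toReal_ofReal (lik_nonneg _ _ _)]

lemma integrable_obsLaw_iff {N : ℕ} (hN : 1 ≤ N) (Y : Mat n p) (F : Mat n p → ℝ) :
    Integrable F (obsLaw N Y) ↔ Integrable fun θ => lik N θ Y * F θ := by
  rw [obsLaw_eq_withDensity hN, integrable_withDensity_iff_integrable_smul'
    (measurable_lik N Y).ennreal_ofReal (by simp)]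
  simp [ENNReal.toReal_ofReal (lik_nonneg _ _ _)]

/-- Standardization: `Y + Z / √N` with `Z` standard normal. -/
lemma obsLaw_eq_map {N : ℕ} (Y : Mat n p) :
    obsLaw N Y = (stdLaw n p).map fun x => Y + (√(N : ℝ))⁻¹ • x := by
  have key : ∀ m : ℝ, gaussianReal m ((N : NNReal)⁻¹) =
      (gaussianReal 0 1).map fun t => m + (√(N : ℝ))⁻¹ * t := fun m => by
    have : (fun t : ℝ => m + (√(N : ℝ))⁻¹ * t) = (m + ·) ∘ ((√(N : ℝ))⁻¹ * ·) := rfl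
    rw [this, ← Measure.map_map (by fun_prop) (by fun_prop), gaussianReal_map_const_mul,
      gaussianReal_map_const_add]
    congr 1
    · simp
    · ext; simp
  unfold stdLaw obsLaw
  have h1 : (fun x : Mat n p => Y + (√(N : ℝ))⁻¹ • x) =
      fun x a => (fun y : Fin p → ℝ => fun i => Y a i + (√(N : ℝ))⁻¹ * y i) (x a) := by
    ext x a i; simp
  simp only [Nat.cast_one, inv_one, Pi.zero_apply]
  have h2 : ∀ a, (Measure.pi fun _ : Fin p => gaussianReal 0 1).map
      (fun y i => Y a i + (√(N : ℝ))⁻¹ * y i) =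
      Measure.pi fun i => gaussianReal (Y a i) ((N : NNReal)⁻¹) := fun a => by
    simp_rw [key]
    have : ∀ i, SigmaFinite ((gaussianReal 0 1).map fun t => Y a i + (√(N : ℝ))⁻¹ * t) :=
      fun i => by rw [← key]; infer_instance
    exact Measure.pi_map_pi (f := fun i t => Y a i + (√(N : ℝ))⁻¹ * t)
      fun i => by fun_prop
  have : ∀ a, SigmaFinite ((Measure.pi fun _ : Fin p => gaussianReal 0 1).map
      (fun y i => Y a i + (√(N : ℝ))⁻¹ * y i)) := fun a => by rw [h2]; infer_instance
  rw [h1, Measure.pi_map_pi (f := fun a (y : Fin p → ℝ) i => Y a i + (√(N : ℝ))⁻¹ * y i)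
    (fun a => Measurable.aemeasurable (by fun_prop))]
  simp_rw [h2]

lemma integral_obsLaw_eq_stdLaw (N : ℕ) (Y : Mat n p) {F : Mat n p → ℝ} (hF : Measurable F) :
    ∫ θ, F θ ∂(obsLaw N Y) = ∫ x, F (Y + (√(N : ℝ))⁻¹ • x) ∂(stdLaw n p) := by
  rw [obsLaw_eq_map, integral_map (by fun_prop) hF.aestronglyMeasurable]

lemma integrable_obsLaw_iff_stdLaw (N : ℕ) (Y : Mat n p) {F : Mat n p → ℝ} (hF : Measurable F) :
    Integrable F (obsLaw N Y) ↔
      Integrable (fun x => F (Y + (√(N : ℝ))⁻¹ • x)) (stdLaw n p) := by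
  rw [obsLaw_eq_map, integrable_map_measure hF.aestronglyMeasurable (by fun_prop)]
  rfl

/-! ### Moments and integration by parts for the standard normal law -/

lemma abs_entry_le_norm (x : Mat n p) (a : Fin n) (i : Fin p) : |x a i| ≤ ‖x‖ :=
  (norm_le_pi_norm (x a) i).trans (norm_le_pi_norm x a)

lemma frobLoss_eq_zero_sub (Y θ : Mat n p) : frobLoss Y θ = frobLoss 0 (θ - Y) := by
  simp [frobLoss]

lemma frobLoss_zero_smul (t : ℝ) (x : Mat n p) : frobLoss 0 (t • x) = t ^ 2 * frobLoss 0 x := by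
  simp [frobLoss, Finset.mul_sum, mul_pow]

lemma norm_sq_le_frobLoss (x : Mat n p) : ‖x‖ ^ 2 ≤ frobLoss 0 x := by
  have h : ‖x‖ ≤ √(frobLoss 0 x) := by
    refine (pi_norm_le_iff_of_nonneg (Real.sqrt_nonneg _)).2 fun a =>
      (pi_norm_le_iff_of_nonneg (Real.sqrt_nonneg _)).2 fun i => ?_
    refine Real.abs_le_sqrt ?_
    unfold frobLoss
    calc x a i ^ 2 = (x a i - (0 : Mat n p) a i) ^ 2 := by simp
      _ ≤ ∑ i, (x a i - (0 : Mat n p) a i) ^ 2 :=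
        Finset.single_le_sum (f := fun i => (x a i - (0 : Mat n p) a i) ^ 2)
          (fun _ _ => sq_nonneg _) (Finset.mem_univ i)
      _ ≤ _ := Finset.single_le_sum (f := fun a => ∑ i, (x a i - (0 : Mat n p) a i) ^ 2)
          (fun _ _ => Finset.sum_nonneg fun _ _ => sq_nonneg _) (Finset.mem_univ a)
  calc ‖x‖ ^ 2 ≤ √(frobLoss 0 x) ^ 2 := by gcongr
    _ = _ := Real.sq_sqrt (frobLoss_nonneg _ _)

lemma one_add_pow_le_exp (k : ℕ) {r : ℝ} (hr : 0 ≤ r) :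
    (1 + r) ^ k ≤ (k.factorial * Real.exp 2) * Real.exp (r ^ 2 / 4) := by
  have h := Real.pow_div_factorial_le_exp (1 + r) (by positivity) k
  rw [div_le_iff₀ (by positivity)] at h
  have h2 : Real.exp (1 + r) ≤ Real.exp 2 * Real.exp (r ^ 2 / 4) := by
    rw [← Real.exp_add]; refine Real.exp_le_exp.2 ?_; nlinarith [sq_nonneg (r / 2 - 1)]
  calc _ ≤ _ := h
    _ ≤ (Real.exp 2 * Real.exp (r ^ 2 / 4)) * k.factorial := by gcongr
    _ = _ := by ring

lemma integrable_exp_neg_frobLoss : Integrable fun x : Mat n p => Real.exp (-frobLoss 0 x / 4) := by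
  have h1 : Integrable fun t : ℝ => Real.exp (-(1 / 4) * t ^ 2) :=
    integrable_exp_neg_mul_sq (by norm_num)
  have h2 : Integrable fun y : Fin p → ℝ => ∏ i, Real.exp (-(1 / 4) * y i ^ 2) :=
    Integrable.fintype_prod (f := fun (_ : Fin p) (t : ℝ) => Real.exp (-(1 / 4) * t ^ 2))
      (fun _ => h1)
  have h3 := Integrable.fintype_prod (μ := fun _ => volume)
    (f := fun (_ : Fin n) (y : Fin p → ℝ) => ∏ i, Real.exp (-(1 / 4) * y i ^ 2)) (fun _ => h2)
  refine h3.congr (ae_of_all _ fun x => ?_)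
  simp_rw [← Real.exp_sum]
  congr 1
  simp only [frobLoss, Pi.zero_apply, sub_zero, ← Finset.mul_sum]
  ring

lemma integrable_one_add_norm_pow (k : ℕ) :
    Integrable (fun x : Mat n p => (1 + ‖x‖) ^ k) (stdLaw n p) := by
  unfold stdLaw
  rw [integrable_obsLaw_iff le_rfl]
  set D := (√(2 * Real.pi * ((1 : ℕ) : ℝ)⁻¹))⁻¹ ^ (n * p)
  refine Integrable.mono' ((integrable_exp_neg_frobLoss (n := n) (p := p)).const_mul
    (D * (k.factorial * Real.exp 2)))
    (((measurable_lik 1 0).mul (by fun_prop)).aestronglyMeasurable) (ae_of_all _ fun x => ?_)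
  rw [Real.norm_of_nonneg (mul_nonneg (lik_nonneg _ _ _) (by positivity)), lik_eq]
  have h1 := one_add_pow_le_exp k (norm_nonneg x)
  have h2 : Real.exp (‖x‖ ^ 2 / 4) ≤ Real.exp (frobLoss 0 x / 4) := by
    gcongr; exact norm_sq_le_frobLoss x
  have hD : 0 ≤ D := by positivity
  calc D * Real.exp (-((1 : ℕ) * frobLoss x 0) / 2) * (1 + ‖x‖) ^ k
      ≤ D * Real.exp (-((1 : ℕ) * frobLoss x 0) / 2) *
        ((k.factorial * Real.exp 2) * Real.exp (frobLoss 0 x / 4)) := by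
        gcongr; exact h1.trans (by gcongr)
    _ = D * (k.factorial * Real.exp 2) * (Real.exp (-((1 : ℕ) * frobLoss x 0) / 2) *
        Real.exp (frobLoss 0 x / 4)) := by ring
    _ = _ := by
      rw [← Real.exp_add, frobLoss_comm x 0]; congr 2; push_cast; ring

lemma integrable_of_le_pow {f : Mat n p → ℝ} (hf : AEStronglyMeasurable f (stdLaw n p)) {C : ℝ}
    {k : ℕ} (h : ∀ x, |f x| ≤ C * (1 + ‖x‖) ^ k) : Integrable f (stdLaw n p) :=
  ((integrable_one_add_norm_pow k).const_mul C).mono' hf (ae_of_all _ h)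

/-- The matrix unit `E_{ai}`. -/
def unitMat (a : Fin n) (i : Fin p) : Mat n p := Pi.single a (Pi.single i 1)

lemma unitMat_apply (a b : Fin n) (i j : Fin p) :
    unitMat a i b j = if b = a ∧ j = i then 1 else 0 := by
  unfold unitMat
  by_cases h : b = a
  · subst h; simp [Pi.single_apply]
  · simp [h]

lemma hasFDerivAt_frobLoss_zero (x : Mat n p) : ∃ L : Mat n p →L[ℝ] ℝ,
    HasFDerivAt (fun x : Mat n p => frobLoss 0 x) L x ∧ ∀ a i, L (unitMat a i) = 2 * x a i := by
  let pr : Fin n → Fin p → (Mat n p →L[ℝ] ℝ) := fun a i =>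
    (ContinuousLinearMap.proj (R := ℝ) (φ := fun _ : Fin p => ℝ) i).comp
      (ContinuousLinearMap.proj (R := ℝ) (φ := fun _ : Fin n => Fin p → ℝ) a)
  have hpr : ∀ a i y, pr a i y = y a i := fun a i y => rfl
  refine ⟨∑ a, ∑ i, (2 * x a i) • pr a i, ?_, fun a i => ?_⟩
  · simp only [frobLoss, Pi.zero_apply, sub_zero]
    refine HasFDerivAt.fun_sum fun a _ => HasFDerivAt.fun_sum fun i _ => ?_
    have := ((pr a i).hasFDerivAt (x := x)).pow 2
    simpa [hpr] using! this
  · simp only [sum_apply, smul_apply, hpr, unitMat_apply,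
      smul_eq_mul, mul_ite, mul_one, mul_zero]
    rw [Finset.sum_eq_single a (by intro b _ hb; simp [hb]) (by simp),
      Finset.sum_eq_single i (by intro b _ hb; simp [hb]) (by simp)]
    simp

lemma hasFDerivAt_lik (x : Mat n p) : ∃ L : Mat n p →L[ℝ] ℝ,
    HasFDerivAt (fun x : Mat n p => lik 1 x 0) L x ∧
      ∀ a i, L (unitMat a i) = -(x a i * lik 1 x 0) := by
  obtain ⟨L, hL, hL2⟩ := hasFDerivAt_frobLoss_zero x
  set D := (√(2 * Real.pi * ((1 : ℕ) : ℝ)⁻¹))⁻¹ ^ (n * p) with hD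
  have := ((hL.const_mul (-(1 / 2))).exp).const_mul D
  refine ⟨_, this.congr_of_eventuallyEq (Eventually.of_forall fun y => ?_), fun a i => ?_⟩
  · dsimp only
    rw [lik_eq, frobLoss_comm]; congr 2; push_cast; ring
  · simp only [smul_apply, hL2, smul_eq_mul]
    rw [lik_eq, frobLoss_comm x 0, ← hD]
    have : -(((1 : ℕ) : ℝ) * frobLoss 0 x) / 2 = -(1 / 2) * frobLoss 0 x := by push_cast; ring
    rw [this]; ring

/-- Stein's identity `E[Z_{ai} f(Z)] = E[∂_{ai} f(Z)]`, for `f` of polynomial growth. -/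
lemma stein {f : Mat n p → ℝ} (hf : ContDiff ℝ 1 f) {C : ℝ} {k : ℕ}
    (h0 : ∀ x, |f x| ≤ C * (1 + ‖x‖) ^ k) (a : Fin n) (i : Fin p)
    (h1 : ∀ x, |fderiv ℝ f x (unitMat a i)| ≤ C * (1 + ‖x‖) ^ k) :
    ∫ x, x a i * f x ∂(stdLaw n p) = ∫ x, fderiv ℝ f x (unitMat a i) ∂(stdLaw n p) := by
  choose L hL hLu using fun x : Mat n p => hasFDerivAt_lik x
  have hfd : Continuous fun x => fderiv ℝ f x (unitMat a i) :=
    (hf.continuous_fderiv one_ne_zero).clm_apply continuous_const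
  have hfderiv : ∀ x, fderiv ℝ (fun x : Mat n p => lik 1 x 0) x (unitMat a i) =
      -(x a i * lik 1 x 0) := fun x => by rw [(hL x).fderiv, hLu]
  have hC : 0 ≤ C := by
    have := (abs_nonneg _).trans (h0 0)
    simpa using this
  have i1 : Integrable (fun x => fderiv ℝ f x (unitMat a i)) (stdLaw n p) :=
    integrable_of_le_pow hfd.aestronglyMeasurable h1
  have i2 : Integrable f (stdLaw n p) :=
    integrable_of_le_pow hf.continuous.aestronglyMeasurable h0
  have i3 : Integrable (fun x => x a i * f x) (stdLaw n p) := by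
    refine integrable_of_le_pow (C := C) (k := k + 1) (Continuous.aestronglyMeasurable
      (by have := hf.continuous; fun_prop)) fun x => ?_
    rw [abs_mul, pow_succ]
    have := abs_entry_le_norm x a i
    calc |x a i| * |f x| ≤ (1 + ‖x‖) * (C * (1 + ‖x‖) ^ k) := by
          gcongr
          · linarith
          · exact h0 x
      _ = _ := by ring
  have e1 := integrable_obsLaw_iff (n := n) (p := p) (le_refl 1) 0
  have e2 := integral_obsLaw (n := n) (p := p) (le_refl 1) 0
  unfold stdLaw at *
  rw [e1] at i1 i2 i3
  rw [e2, e2]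
  have key := integral_mul_fderiv_eq_neg_fderiv_mul_of_integrable (μ := (volume : Measure (Mat n p)))
    (f := f) (g := fun x => lik 1 x 0) (v := unitMat a i)
    (by simpa only [mul_comm] using i1)
    (by
      simp_rw [hfderiv]
      refine i3.neg.congr (ae_of_all _ fun x => ?_)
      simp only [Pi.neg_apply]; ring)
    (by simpa only [mul_comm] using i2)
    (fun x _ => hf.differentiable one_ne_zero x)
    (fun x _ => (hL x).differentiableAt)
  simp_rw [hfderiv] at key
  rw [← neg_eq_iff_eq_neg, ← integral_neg] at key
  calc _ = _ := integral_congr_ae (ae_of_all _ fun x => by ring)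
    _ = _ := key
    _ = _ := integral_congr_ae (ae_of_all _ fun x => by ring)

lemma hasFDerivAt_entry (a : Fin n) (i : Fin p) (x : Mat n p) :
    HasFDerivAt (fun x : Mat n p => x a i)
      ((ContinuousLinearMap.proj (R := ℝ) (φ := fun _ : Fin p => ℝ) i).comp
        (ContinuousLinearMap.proj (R := ℝ) (φ := fun _ : Fin n => Fin p → ℝ) a)) x :=
  ((ContinuousLinearMap.proj (R := ℝ) (φ := fun _ : Fin p => ℝ) i).comp
        (ContinuousLinearMap.proj (R := ℝ) (φ := fun _ : Fin n => Fin p → ℝ) a)).hasFDerivAt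

lemma integrable_entry (a : Fin n) (i : Fin p) :
    Integrable (fun x : Mat n p => x a i) (stdLaw n p) := by
  refine integrable_of_le_pow (C := 1) (k := 1)
    (Continuous.aestronglyMeasurable (by fun_prop)) fun x => ?_
  have := abs_entry_le_norm x a i
  rw [one_mul, pow_one]; linarith

lemma integrable_entry_mul (a b : Fin n) (i j : Fin p) :
    Integrable (fun x : Mat n p => x a i * x b j) (stdLaw n p) := by
  refine integrable_of_le_pow (C := 1) (k := 2)
    (Continuous.aestronglyMeasurable (by fun_prop)) fun x => ?_
  rw [abs_mul, one_mul, sq]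
  have h1 := abs_entry_le_norm x a i
  have h2 := abs_entry_le_norm x b j
  gcongr
  · linarith
  · linarith

lemma integral_entry (a : Fin n) (i : Fin p) : ∫ x : Mat n p, x a i ∂(stdLaw n p) = 0 := by
  have := stein (n := n) (p := p) (f := fun _ => (1 : ℝ)) contDiff_const (C := 1) (k := 0)
    (by simp) a i (by simp)
  simpa using this

lemma integral_entry_mul (a b : Fin n) (i j : Fin p) :
    ∫ x : Mat n p, x a i * x b j ∂(stdLaw n p) = if b = a ∧ j = i then 1 else 0 := by
  have hd : ∀ x : Mat n p, fderiv ℝ (fun x : Mat n p => x b j) x (unitMat a i) =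
      if b = a ∧ j = i then 1 else 0 := fun x => by
    rw [(hasFDerivAt_entry b j x).fderiv, ← unitMat_apply]; rfl
  have := stein (n := n) (p := p) (f := fun x => x b j) (by fun_prop) (C := 1) (k := 1)
    (fun x => by have := abs_entry_le_norm x b j; rw [one_mul, pow_one]; linarith) a i
    (fun x => by
      rw [hd]
      have := norm_nonneg x
      split_ifs <;> norm_num
      linarith)
  rw [this]
  simp_rw [hd]
  simp

/-! ### Priors with uniform Gaussian averages -/

/-- A nonnegative prior density whose Gaussian averages are bounded uniformly in the centre, and
which is almost everywhere at least a constant times an inverse power of `1 + ‖θ‖`. For such a prior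
all the integrals of the Bayes problem converge, with bounds polynomial in `N` and in the
observation. The lower bound holds only almost everywhere because a real power of zero is zero in
Lean, so that the priors of interest vanish where they should be infinite. The weight
`exp(-‖θ - Y‖² / 8)`, wider than the likelihood for every `N ≥ 1`, leaves room for polynomial
factors. -/
structure TamePrior (π : Mat n p → ℝ) : Prop where
  measurable : Measurable π
  nonneg : ∀ θ, 0 ≤ π θ
  lower : ∃ c > 0, ∃ k : ℕ, ∀ᵐ θ, c ≤ π θ * (1 + ‖θ‖) ^ k
  upper : ∃ A : NNReal, ∀ Y, ∫⁻ θ, ENNReal.ofReal (Real.exp (-frobLoss Y θ / 8) * π θ) ≤ A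

lemma measurable_shift {F : Mat n p → ℝ} (hF : Measurable F) (N : ℕ) (Y : Mat n p) :
    Measurable fun x => F (Y + (√(N : ℝ))⁻¹ • x) := hF.comp (by fun_prop)

lemma sqrt_pos {N : ℕ} (hN : 1 ≤ N) : 0 < √(N : ℝ) := Real.sqrt_pos.2 (by exact_mod_cast hN)

lemma one_le_sqrt {N : ℕ} (hN : 1 ≤ N) : 1 ≤ √(N : ℝ) :=
  Real.one_le_sqrt.2 (by exact_mod_cast hN)

lemma inv_sqrt_le_one {N : ℕ} (hN : 1 ≤ N) : (√(N : ℝ))⁻¹ ≤ 1 :=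
  inv_le_one_of_one_le₀ (one_le_sqrt hN)

/-- The Gaussian weight, with its polynomial factor absorbed: at distance at least `√ε` from the
centre it is exponentially small in `N`, relatively to the fixed weight of `TamePrior.upper`. -/
lemma one_add_pow_mul_lik_le (k : ℕ) : ∃ C : ℝ, 0 ≤ C ∧ ∀ N : ℕ, 1 ≤ N → ∀ (Y θ : Mat n p) (ε : ℝ),
    ε ≤ frobLoss Y θ → (1 + ‖(√(N : ℝ)) • (θ - Y)‖) ^ k * lik N θ Y ≤
      C * N ^ (n * p) * Real.exp (-(N * ε) / 8) * Real.exp (-frobLoss Y θ / 8) := by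
  refine ⟨k.factorial * Real.exp 2, by positivity, fun N hN Y θ ε hε => ?_⟩
  have hN0 : (1 : ℝ) ≤ N := by exact_mod_cast hN
  have h1 := one_add_pow_le_exp k (norm_nonneg ((√(N : ℝ)) • (θ - Y)))
  have h2 : ‖(√(N : ℝ)) • (θ - Y)‖ ^ 2 ≤ N * frobLoss Y θ := by
    refine (norm_sq_le_frobLoss _).trans ?_
    rw [frobLoss_zero_smul, Real.sq_sqrt (by positivity), ← frobLoss_eq_zero_sub]
  have h3 : (√(2 * Real.pi * (N : ℝ)⁻¹))⁻¹ ≤ N := by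
    refine inv_le_of_inv_le₀ (by positivity) ?_
    refine Real.le_sqrt_of_sq_le ?_
    have : (N : ℝ)⁻¹ ≤ 1 := inv_le_one_of_one_le₀ hN0
    have h0 : 0 ≤ (N : ℝ)⁻¹ := by positivity
    nlinarith [Real.pi_gt_three]
  have hq := frobLoss_nonneg Y θ
  rw [lik_eq, frobLoss_comm θ Y]
  calc (1 + ‖(√(N : ℝ)) • (θ - Y)‖) ^ k * ((√(2 * Real.pi * (N : ℝ)⁻¹))⁻¹ ^ (n * p) *
          Real.exp (-(N * frobLoss Y θ) / 2))
      ≤ (k.factorial * Real.exp 2 * Real.exp (N * frobLoss Y θ / 4)) * ((N : ℝ) ^ (n * p) *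
          Real.exp (-(N * frobLoss Y θ) / 2)) := by
        gcongr
        exact h1.trans (by gcongr)
    _ = k.factorial * Real.exp 2 * N ^ (n * p) * (Real.exp (N * frobLoss Y θ / 4) *
          Real.exp (-(N * frobLoss Y θ) / 2)) := by ring
    _ ≤ k.factorial * Real.exp 2 * N ^ (n * p) * (Real.exp (-(N * ε) / 8) *
          Real.exp (-frobLoss Y θ / 8)) := by
        rw [← Real.exp_add, ← Real.exp_add]
        refine mul_le_mul_of_nonneg_left (Real.exp_le_exp.2 ?_) (by positivity)
        have e1 : N * ε ≤ N * frobLoss Y θ := by gcongr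
        have e2 : 1 * frobLoss Y θ ≤ N * frobLoss Y θ := by gcongr
        linarith
    _ = _ := by ring

namespace TamePrior

variable {π : Mat n p → ℝ}

/-- A Gaussian average of a piece `F` of a tame prior, with polynomial weight, is at most
polynomial in `N`, and exponentially small if `F` vanishes near the centre. -/
lemma integral_le (hπ : TamePrior π) (k : ℕ) : ∃ C : ℝ, 0 ≤ C ∧ ∀ N : ℕ, 1 ≤ N → ∀ (Y : Mat n p)
    (F : Mat n p → ℝ), Measurable F → (∀ θ, 0 ≤ F θ) → (∀ θ, F θ ≤ π θ) → ∀ ε : ℝ,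
    (∀ θ, F θ ≠ 0 → ε ≤ frobLoss Y θ) →
    Integrable (fun x => (1 + ‖x‖) ^ k * F (Y + (√(N : ℝ))⁻¹ • x)) (stdLaw n p) ∧
    ∫ x, (1 + ‖x‖) ^ k * F (Y + (√(N : ℝ))⁻¹ • x) ∂(stdLaw n p) ≤
      C * N ^ (n * p) * Real.exp (-(N * ε) / 8) := by
  obtain ⟨C, hC, hCb⟩ := one_add_pow_mul_lik_le (n := n) (p := p) k
  obtain ⟨A, hA⟩ := hπ.upper
  refine ⟨C * A, by positivity, fun N hN Y F hFm hF0 hFπ ε hε => ?_⟩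
  have hs := sqrt_pos hN
  set G : Mat n p → ℝ := fun θ => (1 + ‖(√(N : ℝ)) • (θ - Y)‖) ^ k * F θ with hG
  have hGm : Measurable G := by fun_prop
  have hG0 : ∀ θ, 0 ≤ G θ := fun θ => mul_nonneg (by positivity) (hF0 θ)
  have hGx : ∀ x, G (Y + (√(N : ℝ))⁻¹ • x) = (1 + ‖x‖) ^ k * F (Y + (√(N : ℝ))⁻¹ • x) := fun x => by
    simp only [hG, add_sub_cancel_left, smul_smul, mul_inv_cancel₀ hs.ne', one_smul]
  set K := C * N ^ (n * p) * Real.exp (-(N * ε) / 8) with hK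
  have hK0 : 0 ≤ K := by positivity
  have hbound : ∫⁻ θ, ENNReal.ofReal (lik N θ Y * G θ) ≤ ENNReal.ofReal (K * A) := by
    calc ∫⁻ θ, ENNReal.ofReal (lik N θ Y * G θ)
        ≤ ∫⁻ θ, ENNReal.ofReal K * ENNReal.ofReal (Real.exp (-frobLoss Y θ / 8) * π θ) := by
          refine lintegral_mono fun θ => ?_
          rw [← ENNReal.ofReal_mul hK0]
          refine ENNReal.ofReal_le_ofReal ?_
          by_cases h : F θ = 0
          · simp only [hG, h, mul_zero]
            exact mul_nonneg hK0 (mul_nonneg (Real.exp_nonneg _) (hπ.nonneg θ))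
          · calc lik N θ Y * G θ
                = ((1 + ‖(√(N : ℝ)) • (θ - Y)‖) ^ k * lik N θ Y) * F θ := by simp only [hG]; ring
              _ ≤ (K * Real.exp (-frobLoss Y θ / 8)) * F θ := by
                  exact mul_le_mul_of_nonneg_right (hCb N hN Y θ ε (hε θ h)) (hF0 θ)
              _ ≤ (K * Real.exp (-frobLoss Y θ / 8)) * π θ := by gcongr; exact hFπ θ
              _ = _ := by ring
      _ = ENNReal.ofReal K * ∫⁻ θ, ENNReal.ofReal (Real.exp (-frobLoss Y θ / 8) * π θ) :=
          lintegral_const_mul' _ _ ENNReal.ofReal_ne_top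
      _ ≤ ENNReal.ofReal K * A := by gcongr; exact hA Y
      _ = _ := by rw [ENNReal.ofReal_mul hK0, ENNReal.ofReal_coe_nnreal]
  have hlG0 : ∀ θ, 0 ≤ lik N θ Y * G θ := fun θ => mul_nonneg (lik_nonneg _ _ _) (hG0 θ)
  have hlGm : AEStronglyMeasurable (fun θ => lik N θ Y * G θ) :=
    ((measurable_lik N Y).mul hGm).aestronglyMeasurable
  have hint : Integrable fun θ => lik N θ Y * G θ := by
    refine ⟨hlGm, ?_⟩
    rw [hasFiniteIntegral_iff_ofReal (ae_of_all _ hlG0)]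
    exact hbound.trans_lt ENNReal.ofReal_lt_top
  simp_rw [← hGx]
  refine ⟨(integrable_obsLaw_iff_stdLaw N Y hGm).1 ((integrable_obsLaw_iff hN Y G).2 hint), ?_⟩
  rw [← integral_obsLaw_eq_stdLaw N Y hGm, integral_obsLaw hN,
    integral_eq_lintegral_of_nonneg_ae (ae_of_all _ hlG0) hlGm]
  refine (ENNReal.toReal_le_of_le_ofReal (by positivity) hbound).trans (le_of_eq ?_)
  rw [hK]; ring

lemma integrable_pow_mul (hπ : TamePrior π) (k : ℕ) {N : ℕ} (hN : 1 ≤ N) (Y : Mat n p) :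
    Integrable (fun x => (1 + ‖x‖) ^ k * π (Y + (√(N : ℝ))⁻¹ • x)) (stdLaw n p) := by
  obtain ⟨C, -, h⟩ := hπ.integral_le k
  exact (h N hN Y π hπ.measurable hπ.nonneg (fun _ => le_rfl) 0
    fun θ _ => frobLoss_nonneg Y θ).1

lemma integrable_shift (hπ : TamePrior π) {N : ℕ} (hN : 1 ≤ N) (Y : Mat n p) :
    Integrable (fun x => π (Y + (√(N : ℝ))⁻¹ • x)) (stdLaw n p) := by
  simpa using hπ.integrable_pow_mul 0 hN Y

lemma integrable_entry_mul_shift (hπ : TamePrior π) {N : ℕ} (hN : 1 ≤ N) (Y : Mat n p) (a : Fin n)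
    (i : Fin p) : Integrable (fun x => x a i * π (Y + (√(N : ℝ))⁻¹ • x)) (stdLaw n p) := by
  refine (hπ.integrable_pow_mul 1 hN Y).mono'
    (Measurable.mul (f := fun x : Mat n p => x a i) (by fun_prop)
      (measurable_shift hπ.measurable N Y)).aestronglyMeasurable (ae_of_all _ fun x => ?_)
  rw [Real.norm_eq_abs, abs_mul, abs_of_nonneg (hπ.nonneg _), pow_one]
  gcongr
  · exact hπ.nonneg _
  · linarith [abs_entry_le_norm x a i]

end TamePrior

lemma marginal_eq (π : Mat n p → ℝ) (hπ : Measurable π) {N : ℕ} (hN : 1 ≤ N) (Y : Mat n p) :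
    marginal π N Y = ∫ x, π (Y + (√(N : ℝ))⁻¹ • x) ∂(stdLaw n p) := by
  rw [marginal, ← integral_obsLaw hN, integral_obsLaw_eq_stdLaw N Y hπ]

/-- The gradient of the logarithm of the marginal density, written without derivatives as
`√N E[Z π(Y + Z/√N)] / E[π(Y + Z/√N)]`. -/
noncomputable def score (π : Mat n p → ℝ) (N : ℕ) (Y : Mat n p) (a : Fin n) (i : Fin p) : ℝ :=
  √(N : ℝ) * (∫ x, x a i * π (Y + (√(N : ℝ))⁻¹ • x) ∂(stdLaw n p)) / marginal π N Y

namespace TamePrior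

variable {π : Mat n p → ℝ}

/-- The marginal density decays at most polynomially, uniformly in `N`. -/
lemma le_marginal (hπ : TamePrior π) : ∃ c > 0, ∃ k : ℕ, ∀ N : ℕ, 1 ≤ N → ∀ Y : Mat n p,
    c ≤ marginal π N Y * (1 + ‖Y‖) ^ k := by
  obtain ⟨c, hc, k, h⟩ := hπ.lower
  have hpos : ∀ x : Mat n p, 0 < (1 + ‖x‖) ^ k := fun x => by positivity
  have hcont : Continuous fun x : Mat n p => ((1 + ‖x‖) ^ k)⁻¹ :=
    Continuous.inv₀ (by fun_prop) fun x => (hpos x).ne'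
  have hle1 : ∀ x : Mat n p, ((1 + ‖x‖) ^ k)⁻¹ ≤ 1 := fun x =>
    inv_le_one_of_one_le₀ (one_le_pow₀ (by linarith [norm_nonneg x]))
  have hI : Integrable (fun x : Mat n p => ((1 + ‖x‖) ^ k)⁻¹) (stdLaw n p) :=
    integrable_of_le_pow (C := 1) (k := 0) hcont.aestronglyMeasurable fun x => by
      rw [abs_of_pos (inv_pos.2 (hpos x))]; simpa using hle1 x
  have hIpos : 0 < ∫ x : Mat n p, ((1 + ‖x‖) ^ k)⁻¹ ∂(stdLaw n p) := by
    rw [integral_pos_iff_support_of_nonneg (fun x => (inv_pos.2 (hpos x)).le) hI]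
    have : Function.support (fun x : Mat n p => ((1 + ‖x‖) ^ k)⁻¹) = Set.univ := by
      ext x; simpa using (hpos x).ne'
    rw [this]; simp
  refine ⟨c * ∫ x : Mat n p, ((1 + ‖x‖) ^ k)⁻¹ ∂(stdLaw n p), by positivity, k,
    fun N hN Y => ?_⟩
  rw [marginal_eq π hπ.measurable hN, ← integral_const_mul, ← integral_mul_const]
  refine integral_mono_ae (hI.const_mul c) ((hπ.integrable_shift hN Y).mul_const _) ?_
  have hae : ∀ᵐ x ∂(stdLaw n p), c ≤ π (Y + (√(N : ℝ))⁻¹ • x) *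
      (1 + ‖Y + (√(N : ℝ))⁻¹ • x‖) ^ k := by
    refine ae_of_ae_map (f := fun x => Y + (√(N : ℝ))⁻¹ • x)
      (p := fun θ => c ≤ π θ * (1 + ‖θ‖) ^ k) (by fun_prop) ?_
    rw [← obsLaw_eq_map, obsLaw_eq_withDensity hN]
    exact (withDensity_absolutelyContinuous _ _).ae_le h
  filter_upwards [hae] with x hx
  rw [← div_eq_mul_inv, div_le_iff₀ (hpos x)]
  refine hx.trans ?_
  rw [mul_assoc, ← mul_pow]
  gcongr
  · exact hπ.nonneg _
  · have h1 : ‖Y + (√(N : ℝ))⁻¹ • x‖ ≤ ‖Y‖ + ‖x‖ := by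
      refine (norm_add_le _ _).trans ?_
      gcongr
      rw [norm_smul, Real.norm_of_nonneg (by positivity)]
      exact mul_le_of_le_one_left (norm_nonneg _) (inv_sqrt_le_one hN)
    nlinarith [norm_nonneg x, norm_nonneg Y, mul_nonneg (norm_nonneg x) (norm_nonneg Y)]

lemma marginal_pos (hπ : TamePrior π) {N : ℕ} (hN : 1 ≤ N) (Y : Mat n p) :
    0 < marginal π N Y := by
  obtain ⟨c, hc, k, h⟩ := hπ.le_marginal
  exact pos_of_mul_pos_left (hc.trans_le (h N hN Y)) (by positivity)

/-- Tweedie's formula `δ_π(Y) = Y + N⁻¹ ∇ log m_π(Y)`. -/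
lemma genBayes_eq (hπ : TamePrior π) {N : ℕ} (hN : 1 ≤ N) (Y : Mat n p) (a : Fin n) (i : Fin p) :
    genBayes π N Y a i = Y a i + (N : ℝ)⁻¹ * score π N Y a i := by
  have hm := (hπ.marginal_pos hN Y).ne'
  have hs := (sqrt_pos hN).ne'
  have hss : √(N : ℝ) ^ 2 = N := Real.sq_sqrt (by positivity)
  have h1 : ∫ θ : Mat n p, θ a i * (lik N θ Y * π θ) =
      Y a i * marginal π N Y + (√(N : ℝ))⁻¹ *
        ∫ x, x a i * π (Y + (√(N : ℝ))⁻¹ • x) ∂(stdLaw n p) := by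
    have : ∀ θ : Mat n p, θ a i * (lik N θ Y * π θ) = lik N θ Y * (θ a i * π θ) :=
      fun θ => by ring
    have hmm : Measurable fun θ : Mat n p => θ a i * π θ := by
      have := hπ.measurable
      fun_prop
    simp_rw [this]
    rw [← integral_obsLaw hN Y (fun θ => θ a i * π θ),
      integral_obsLaw_eq_stdLaw N Y hmm,
      marginal_eq π hπ.measurable hN, ← integral_const_mul, ← integral_const_mul,
      ← integral_add ((hπ.integrable_shift hN Y).const_mul _)
        ((hπ.integrable_entry_mul_shift hN Y a i).const_mul _)]
    refine integral_congr_ae (ae_of_all _ fun x => ?_)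
    simp only [Pi.add_apply, Pi.smul_apply, smul_eq_mul]
    ring
  have h2 : (√(N : ℝ))⁻¹ = (N : ℝ)⁻¹ * √(N : ℝ) := by
    nth_rewrite 2 [← hss]; field_simp
  rw [genBayes, h1, score]
  generalize ∫ x, x a i * π (Y + (√(N : ℝ))⁻¹ • x) ∂(stdLaw n p) = I
  rw [h2]
  field_simp

lemma posteriorMeanExists (hπ : TamePrior π) {N : ℕ} (hN : 1 ≤ N) : PosteriorMeanExists π N := by
  intro Y
  have hm := hπ.measurable
  refine ⟨?_, hπ.marginal_pos hN Y, fun a i => ?_⟩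
  · rw [← integrable_obsLaw_iff hN Y π, integrable_obsLaw_iff_stdLaw N Y hm]
    exact hπ.integrable_shift hN Y
  · have : ∀ θ : Mat n p, θ a i * (lik N θ Y * π θ) = lik N θ Y * (θ a i * π θ) :=
      fun θ => by ring
    simp_rw [this]
    rw [← integrable_obsLaw_iff hN Y (fun θ => θ a i * π θ),
      integrable_obsLaw_iff_stdLaw N Y (by fun_prop)]
    refine (((hπ.integrable_shift hN Y).const_mul (Y a i)).add
      ((hπ.integrable_entry_mul_shift hN Y a i).const_mul (√(N : ℝ))⁻¹)).congr
      (ae_of_all _ fun x => ?_)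
    simp only [Pi.add_apply, Pi.smul_apply, smul_eq_mul]
    ring

/-- The score is polynomially bounded in `N` and in the observation. -/
lemma abs_score_le (hπ : TamePrior π) : ∃ C : ℝ, 0 ≤ C ∧ ∃ k : ℕ, ∀ N : ℕ, 1 ≤ N →
    ∀ (Y : Mat n p) (a : Fin n) (i : Fin p),
      |score π N Y a i| ≤ C * N ^ (n * p + 1) * (1 + ‖Y‖) ^ k := by
  obtain ⟨c, hc, k, h⟩ := hπ.le_marginal
  obtain ⟨C, hC, hC'⟩ := hπ.integral_le 1
  refine ⟨C / c, by positivity, k, fun N hN Y a i => ?_⟩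
  have hm := hπ.marginal_pos hN Y
  have hN0 : (1 : ℝ) ≤ N := by exact_mod_cast hN
  obtain ⟨hi, hb⟩ := hC' N hN Y π hπ.measurable hπ.nonneg (fun _ => le_rfl) 0
    fun θ _ => frobLoss_nonneg Y θ
  have h1 : |∫ x, x a i * π (Y + (√(N : ℝ))⁻¹ • x) ∂(stdLaw n p)| ≤ C * N ^ (n * p) := by
    calc |∫ x, x a i * π (Y + (√(N : ℝ))⁻¹ • x) ∂(stdLaw n p)|
        ≤ ∫ x, (1 + ‖x‖) ^ 1 * π (Y + (√(N : ℝ))⁻¹ • x) ∂(stdLaw n p) := by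
          rw [← Real.norm_eq_abs]
          refine norm_integral_le_of_norm_le hi (ae_of_all _ fun x => ?_)
          rw [Real.norm_eq_abs, abs_mul, abs_of_nonneg (hπ.nonneg _), pow_one]
          gcongr
          · exact hπ.nonneg _
          · linarith [abs_entry_le_norm x a i]
      _ ≤ _ := by simpa using hb
  have h2 : √(N : ℝ) ≤ N := by
    rw [Real.sqrt_le_left (by positivity)]; nlinarith
  rw [score, abs_div, abs_mul, abs_of_pos hm, abs_of_pos (sqrt_pos hN), div_le_iff₀ hm]
  have h3 : 1 ≤ (marginal π N Y * (1 + ‖Y‖) ^ k) / c := by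
    rw [le_div_iff₀ hc, one_mul]; exact h N hN Y
  calc √(N : ℝ) * |∫ x, x a i * π (Y + (√(N : ℝ))⁻¹ • x) ∂(stdLaw n p)|
      ≤ (N * (C * N ^ (n * p))) * 1 := by rw [mul_one]; gcongr
    _ ≤ (N * (C * N ^ (n * p))) * ((marginal π N Y * (1 + ‖Y‖) ^ k) / c) := by gcongr
    _ = _ := by ring

lemma measurable_marginal (hπ : TamePrior π) (N : ℕ) : Measurable (marginal π N) := by
  have h : StronglyMeasurable (Function.uncurry fun Y θ : Mat n p => lik N θ Y * π θ) := by
    refine Measurable.stronglyMeasurable ?_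
    refine Measurable.mul (f := fun q : Mat n p × Mat n p => lik N q.2 q.1)
      ((continuous_lik N).comp continuous_swap).measurable (hπ.measurable.comp measurable_snd)
  exact h.integral_prod_right.measurable

lemma measurable_genBayes (hπ : TamePrior π) (N : ℕ) : Measurable (genBayes π N) := by
  refine measurable_pi_lambda _ fun a => measurable_pi_lambda _ fun i => ?_
  refine Measurable.div ?_ (hπ.measurable_marginal N)
  have h : StronglyMeasurable
      (Function.uncurry fun Y θ : Mat n p => θ a i * (lik N θ Y * π θ)) := by
    refine Measurable.stronglyMeasurable ?_
    refine Measurable.mul (f := fun q : Mat n p × Mat n p => q.2 a i) (by fun_prop) ?_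
    refine Measurable.mul (f := fun q : Mat n p × Mat n p => lik N q.2 q.1)
      ((continuous_lik N).comp continuous_swap).measurable (hπ.measurable.comp measurable_snd)
  exact h.integral_prod_right.measurable

lemma measurable_score (hπ : TamePrior π) {N : ℕ} (hN : 1 ≤ N) (a : Fin n) (i : Fin p) :
    Measurable fun Y => score π N Y a i := by
  have h : (fun Y => score π N Y a i) = fun Y => N * (genBayes π N Y a i - Y a i) := by
    ext Y
    have : (N : ℝ) ≠ 0 := by exact_mod_cast (by omega : N ≠ 0)
    rw [hπ.genBayes_eq hN]; field_simp; ring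
  rw [h]
  have := hπ.measurable_genBayes N
  fun_prop

end TamePrior

/-! ### First-order expansion of the score at scale `1 / √N` -/

/-- The functions `h N` have, on the scale `1 / √N` around `M`, the first-order expansion
`h N (M + z / √N) = v + L z / √N + o(1 / √N)`, in the form suited to dominated convergence: the
scaled increments converge for each `z`, and are at most linear in `z` as long as the argument
stays in a fixed ball around `M`. -/
structure ExpandsAt (h : ℕ → Mat n p → ℝ) (M : Mat n p) (v : ℝ) (L : Mat n p → ℝ) : Prop where
  center : Tendsto (fun N => h N M) atTop (𝓝 v)
  incr : ∀ z, Tendsto (fun N : ℕ => √(N : ℝ) * (h N (M + (√(N : ℝ))⁻¹ • z) - h N M)) atTop (𝓝 (L z))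
  center_le : ∃ C, 0 ≤ C ∧ ∀ N, 1 ≤ N → |h N M| ≤ C
  incr_le : ∃ ε > 0, ∃ C, 0 ≤ C ∧ ∀ N : ℕ, 1 ≤ N → ∀ z, ‖z‖ ≤ ε * √(N : ℝ) →
    |√(N : ℝ) * (h N (M + (√(N : ℝ))⁻¹ • z) - h N M)| ≤ C * (1 + ‖z‖)

lemma tendsto_inv_sqrt : Tendsto (fun N : ℕ => (√(N : ℝ))⁻¹) atTop (𝓝 0) :=
  tendsto_inv_atTop_zero.comp (Real.tendsto_sqrt_atTop.comp tendsto_natCast_atTop_atTop)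

lemma tendsto_add_inv_sqrt_smul (M z : Mat n p) :
    Tendsto (fun N : ℕ => M + (√(N : ℝ))⁻¹ • z) atTop (𝓝 M) := by
  simpa using tendsto_const_nhds.add (tendsto_inv_sqrt.smul_const z)

lemma norm_inv_sqrt_smul_le {N : ℕ} (hN : 1 ≤ N) {ε : ℝ} {z : Mat n p} (hz : ‖z‖ ≤ ε * √(N : ℝ)) :
    ‖(√(N : ℝ))⁻¹ • z‖ ≤ ε := by
  have := sqrt_pos hN
  rw [norm_smul, Real.norm_of_nonneg (by positivity), inv_mul_le_iff₀ this, mul_comm]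
  exact hz

namespace ExpandsAt

variable {h g : ℕ → Mat n p → ℝ} {M : Mat n p} {v w : ℝ} {L L' : Mat n p → ℝ}

lemma tendsto_shift (hh : ExpandsAt h M v L) (z : Mat n p) :
    Tendsto (fun N : ℕ => h N (M + (√(N : ℝ))⁻¹ • z)) atTop (𝓝 v) := by
  have h1 := tendsto_inv_sqrt.mul (hh.incr z)
  have h2 := hh.center.add h1
  rw [zero_mul, add_zero] at h2
  refine h2.congr' ?_
  filter_upwards [eventually_ge_atTop 1] with N hN
  have := (sqrt_pos hN).ne'
  field_simp
  ring

lemma shift_le (hh : ExpandsAt h M v L) : ∃ ε > 0, ∃ C, 0 ≤ C ∧ ∀ N : ℕ, 1 ≤ N → ∀ z,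
    ‖z‖ ≤ ε * √(N : ℝ) → |h N (M + (√(N : ℝ))⁻¹ • z)| ≤ C := by
  obtain ⟨C₁, hC₁, h1⟩ := hh.center_le
  obtain ⟨ε, hε, C₂, hC₂, h2⟩ := hh.incr_le
  refine ⟨ε, hε, C₁ + C₂ * (1 + ε), by positivity, fun N hN z hz => ?_⟩
  have hs := sqrt_pos hN
  have hs1 := one_le_sqrt hN
  have h3 := h2 N hN z hz
  rw [abs_mul, abs_of_pos hs] at h3
  have h4 : |h N (M + (√(N : ℝ))⁻¹ • z) - h N M| ≤ C₂ * (1 + ε) := by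
    refine le_of_mul_le_mul_left (h3.trans ?_) hs
    calc C₂ * (1 + ‖z‖) ≤ C₂ * (√(N : ℝ) + ε * √(N : ℝ)) := by gcongr
      _ = _ := by ring
  have h5 := h1 N hN
  calc |h N (M + (√(N : ℝ))⁻¹ • z)| = |h N M + (h N (M + (√(N : ℝ))⁻¹ • z) - h N M)| := by
        congr 1; ring
    _ ≤ _ := (abs_add_le _ _).trans (add_le_add h5 h4)

/-- A perturbation that is uniformly `o(1 / √N)` near `M` does not change the expansion. -/
lemma add_small (hh : ExpandsAt h M v L) {r : ℕ → Mat n p → ℝ} {ε : ℝ} (hε : 0 < ε) {τ : ℕ → ℝ}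
    (hτ : Tendsto τ atTop (𝓝 0))
    (hr : ∀ N : ℕ, 1 ≤ N → ∀ Y, ‖Y - M‖ ≤ ε → √(N : ℝ) * |r N Y| ≤ τ N) :
    ExpandsAt (fun N Y => h N Y + r N Y) M v L := by
  obtain ⟨B, hB⟩ := hτ.bddAbove_range
  have hB' : ∀ N, τ N ≤ B := fun N => hB ⟨N, rfl⟩
  have hrM : ∀ N : ℕ, 1 ≤ N → √(N : ℝ) * |r N M| ≤ τ N := fun N hN => hr N hN M (by simpa using hε.le)
  have hrM' : ∀ N : ℕ, 1 ≤ N → |r N M| ≤ τ N := fun N hN =>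
    (le_mul_of_one_le_left (abs_nonneg _) (one_le_sqrt hN)).trans (hrM N hN)
  have hB0 : 0 ≤ B := (abs_nonneg _).trans ((hrM' 1 le_rfl).trans (hB' 1))
  refine ⟨?_, fun z => ?_, ?_, ?_⟩
  · have : Tendsto (fun N => r N M) atTop (𝓝 0) := by
      refine squeeze_zero_norm' ?_ hτ
      filter_upwards [eventually_ge_atTop 1] with N hN using hrM' N hN
    simpa using hh.center.add this
  · have h1 : Tendsto (fun N : ℕ => √(N : ℝ) * (r N (M + (√(N : ℝ))⁻¹ • z) - r N M))
        atTop (𝓝 0) := by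
      have h2τ : Tendsto (fun N => τ N + τ N) atTop (𝓝 0) := by simpa using hτ.add hτ
      refine squeeze_zero_norm' ?_ h2τ
      have hball := (tendsto_add_inv_sqrt_smul M z).eventually (Metric.closedBall_mem_nhds M hε)
      filter_upwards [eventually_ge_atTop 1, hball] with N hN hY
      have h3 := hr N hN _ (mem_closedBall_iff_norm.1 hY)
      rw [norm_mul, Real.norm_of_nonneg (Real.sqrt_nonneg _)]
      calc √(N : ℝ) * ‖r N (M + (√(N : ℝ))⁻¹ • z) - r N M‖
          ≤ √(N : ℝ) * (|r N (M + (√(N : ℝ))⁻¹ • z)| + |r N M|) := by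
            gcongr; exact abs_sub _ _
        _ ≤ _ := by rw [mul_add]; exact add_le_add h3 (hrM N hN)
    have h2 := (hh.incr z).add h1
    rw [add_zero] at h2
    exact h2.congr fun N => by ring
  · obtain ⟨C, hC, h1⟩ := hh.center_le
    exact ⟨C + B, by positivity, fun N hN => (abs_add_le _ _).trans
      (add_le_add (h1 N hN) ((hrM' N hN).trans (hB' N)))⟩
  · obtain ⟨ε', hε', C, hC, h1⟩ := hh.incr_le
    refine ⟨min ε ε', lt_min hε hε', C + 2 * B, by positivity, fun N hN z hz => ?_⟩
    have hs := sqrt_pos hN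
    have h2 := h1 N hN z (hz.trans (by gcongr; exact min_le_right _ _))
    have h3 := hr N hN (M + (√(N : ℝ))⁻¹ • z) (by
      rw [add_sub_cancel_left]
      exact norm_inv_sqrt_smul_le hN (hz.trans (by gcongr; exact min_le_left _ _)))
    have h4 := (h3.trans (hB' N))
    have h5 := ((hrM N hN).trans (hB' N))
    calc |√(N : ℝ) * (h N (M + (√(N : ℝ))⁻¹ • z) + r N (M + (√(N : ℝ))⁻¹ • z) - (h N M + r N M))|
        = |√(N : ℝ) * (h N (M + (√(N : ℝ))⁻¹ • z) - h N M) +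
            (√(N : ℝ) * r N (M + (√(N : ℝ))⁻¹ • z) - √(N : ℝ) * r N M)| := by congr 1; ring
      _ ≤ |√(N : ℝ) * (h N (M + (√(N : ℝ))⁻¹ • z) - h N M)| +
            (|√(N : ℝ) * r N (M + (√(N : ℝ))⁻¹ • z)| + |√(N : ℝ) * r N M|) :=
          (abs_add_le _ _).trans (add_le_add le_rfl (abs_sub _ _))
      _ ≤ C * (1 + ‖z‖) + (B + B) := by
          rw [abs_mul _ (r N _), abs_mul _ (r N M), abs_of_pos hs]
          exact add_le_add h2 (add_le_add h4 h5)
      _ ≤ _ := by nlinarith [norm_nonneg z]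

/-- The quotient rule. -/
lemma div (hh : ExpandsAt h M v L) (hg : ExpandsAt g M w L') (hw : w ≠ 0) {ε c : ℝ} (hε : 0 < ε)
    (hc : 0 < c) (hgc : ∀ N : ℕ, 1 ≤ N → ∀ Y, ‖Y - M‖ ≤ ε → c ≤ g N Y) :
    ExpandsAt (fun N Y => h N Y / g N Y) M (v / w) (fun z => (L z - v / w * L' z) / w) := by
  have hgM : ∀ N : ℕ, 1 ≤ N → c ≤ g N M := fun N hN => hgc N hN M (by simpa using hε.le)
  -- the increment of the quotient, in terms of the increments of both functions
  have key : ∀ N : ℕ, ∀ z, 1 ≤ N → g N (M + (√(N : ℝ))⁻¹ • z) ≠ 0 → g N M ≠ 0 →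
      √(N : ℝ) * (h N (M + (√(N : ℝ))⁻¹ • z) / g N (M + (√(N : ℝ))⁻¹ • z) - h N M / g N M) =
      (√(N : ℝ) * (h N (M + (√(N : ℝ))⁻¹ • z) - h N M) - h N M / g N M *
        (√(N : ℝ) * (g N (M + (√(N : ℝ))⁻¹ • z) - g N M))) / g N (M + (√(N : ℝ))⁻¹ • z) := by
    intro N z _ h1 h2
    generalize g N (M + (√(N : ℝ))⁻¹ • z) = t at *
    field_simp
    ring
  refine ⟨hh.center.div hg.center hw, fun z => ?_, ?_, ?_⟩
  · have h1 := (((hh.incr z).sub ((hh.center.div hg.center hw).mul (hg.incr z))).div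
      (hg.tendsto_shift z) hw)
    refine h1.congr' ?_
    have hball := (tendsto_add_inv_sqrt_smul M z).eventually (Metric.closedBall_mem_nhds M hε)
    filter_upwards [eventually_ge_atTop 1, hball] with N hN hY
    exact (key N z hN (hc.trans_le (hgc N hN _ (mem_closedBall_iff_norm.1 hY))).ne'
      (hc.trans_le (hgM N hN)).ne').symm
  · obtain ⟨C, hC, h1⟩ := hh.center_le
    refine ⟨C / c, by positivity, fun N hN => ?_⟩
    have := hgM N hN
    rw [abs_div, abs_of_pos (hc.trans_le this)]
    gcongr
    exact h1 N hN
  · obtain ⟨C₀, hC₀, h0⟩ := hh.center_le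
    obtain ⟨ε₁, hε₁, C₁, hC₁, h1⟩ := hh.incr_le
    obtain ⟨ε₂, hε₂, C₂, hC₂, h2⟩ := hg.incr_le
    refine ⟨min ε (min ε₁ ε₂), by positivity, (C₁ + C₀ / c * C₂) / c, by positivity,
      fun N hN z hz => ?_⟩
    have hs := sqrt_pos hN
    have e1 := h1 N hN z (hz.trans (by gcongr; exact (min_le_right _ _).trans (min_le_left _ _)))
    have e2 := h2 N hN z (hz.trans (by gcongr; exact (min_le_right _ _).trans (min_le_right _ _)))
    have e3 := hgc N hN (M + (√(N : ℝ))⁻¹ • z) (by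
      rw [add_sub_cancel_left]
      exact norm_inv_sqrt_smul_le hN (hz.trans (by gcongr; exact min_le_left _ _)))
    have e4 := hgM N hN
    rw [key N z hN (hc.trans_le e3).ne' (hc.trans_le e4).ne', abs_div,
      abs_of_pos (hc.trans_le e3)]
    have e5 : |h N M / g N M| ≤ C₀ / c := by
      rw [abs_div, abs_of_pos (hc.trans_le e4)]
      gcongr
      exact h0 N hN
    calc _ ≤ (C₁ * (1 + ‖z‖) + C₀ / c * (C₂ * (1 + ‖z‖))) / c := by
          gcongr
          refine (abs_sub _ _).trans (add_le_add e1 ?_)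
          rw [abs_mul]
          gcongr
      _ = _ := by ring

end ExpandsAt

/-- The convolution of a `C¹` function of compact support with the law of `Z / √N`. -/
lemma expandsAt_average {f : Mat n p → ℝ} (hf : ContDiff ℝ 1 f) (hs : HasCompactSupport f)
    (M : Mat n p) : ExpandsAt (fun N Y => ∫ x, f (Y + (√(N : ℝ))⁻¹ • x) ∂(stdLaw n p)) M (f M)
      (fun z => fderiv ℝ f M z) := by
  obtain ⟨B, hB⟩ := hf.continuous.bounded_above_of_compact_support hs
  obtain ⟨K, hK⟩ := hf.lipschitzWith_of_hasCompactSupport hs one_ne_zero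
  have hm : ∀ (N : ℕ) (Y : Mat n p), AEStronglyMeasurable (fun x => f (Y + (√(N : ℝ))⁻¹ • x))
      (stdLaw n p) := fun N Y => (measurable_shift hf.continuous.measurable N Y).aestronglyMeasurable
  have hi : ∀ (N : ℕ) (Y : Mat n p), Integrable (fun x => f (Y + (√(N : ℝ))⁻¹ • x))
      (stdLaw n p) := fun N Y => Integrable.of_bound (hm N Y) B (ae_of_all _ fun x => hB _)
  have hle : ∀ (N : ℕ), 1 ≤ N → ∀ z x : Mat n p,
      ‖√(N : ℝ) * (f (M + (√(N : ℝ))⁻¹ • z + (√(N : ℝ))⁻¹ • x) - f (M + (√(N : ℝ))⁻¹ • x))‖ ≤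
      K * ‖z‖ := fun N hN z x => by
    have hs := sqrt_pos hN
    rw [norm_mul, Real.norm_of_nonneg hs.le]
    have h1 := hK.norm_sub_le (M + (√(N : ℝ))⁻¹ • z + (√(N : ℝ))⁻¹ • x) (M + (√(N : ℝ))⁻¹ • x)
    have h2 : M + (√(N : ℝ))⁻¹ • z + (√(N : ℝ))⁻¹ • x - (M + (√(N : ℝ))⁻¹ • x) =
      (√(N : ℝ))⁻¹ • z := by abel
    rw [h2, norm_smul, norm_inv, Real.norm_of_nonneg hs.le] at h1
    calc _ ≤ √(N : ℝ) * (K * ((√(N : ℝ))⁻¹ * ‖z‖)) := by gcongr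
      _ = _ := by field_simp
  have heq : ∀ (N : ℕ) (z : Mat n p),
      √(N : ℝ) * (∫ x, f (M + (√(N : ℝ))⁻¹ • z + (√(N : ℝ))⁻¹ • x) ∂(stdLaw n p) -
        ∫ x, f (M + (√(N : ℝ))⁻¹ • x) ∂(stdLaw n p)) =
      ∫ x, √(N : ℝ) * (f (M + (√(N : ℝ))⁻¹ • z + (√(N : ℝ))⁻¹ • x) - f (M + (√(N : ℝ))⁻¹ • x))
        ∂(stdLaw n p) := fun N z => by
    rw [integral_const_mul, integral_sub (hi N _) (hi N _)]
  refine ⟨?_, fun z => ?_, ⟨|B|, abs_nonneg _, fun N _ => ?_⟩,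
    ⟨1, one_pos, K, K.2, fun N hN z _ => ?_⟩⟩
  · have h1 : Tendsto (fun N : ℕ => ∫ x, f (M + (√(N : ℝ))⁻¹ • x) ∂(stdLaw n p)) atTop
        (𝓝 (∫ _, f M ∂(stdLaw n p))) := by
      refine tendsto_integral_of_dominated_convergence (fun _ => B) (fun N => hm N M)
        (integrable_const B) (fun N => ae_of_all _ fun x => hB _) (ae_of_all _ fun x => ?_)
      exact (hf.continuous.tendsto M).comp (tendsto_add_inv_sqrt_smul M x)
    simpa using h1
  · simp_rw [heq]
    have h1 : ∫ _, fderiv ℝ f M z ∂(stdLaw n p) = fderiv ℝ f M z := by simp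
    rw [← h1]
    refine tendsto_integral_filter_of_dominated_convergence (fun _ => K * ‖z‖)
      (Eventually.of_forall fun N => (((hm N _).sub (hm N _)).const_mul _)) ?_
      (integrable_const _) (ae_of_all _ fun x => ?_)
    · filter_upwards [eventually_ge_atTop 1] with N hN using ae_of_all _ fun x => hle N hN z x
    · -- strict differentiability, as both arguments move
      have hst := (hf.contDiffAt (x := M)).hasStrictFDerivAt one_ne_zero
      have ht1 : Tendsto (fun N : ℕ => M + (√(N : ℝ))⁻¹ • z + (√(N : ℝ))⁻¹ • x) atTop (𝓝 M) := by
        refine (tendsto_add_inv_sqrt_smul M (z + x)).congr fun N => ?_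
        rw [smul_add, add_assoc]
      have h2 := hst.isLittleO.comp_tendsto (ht1.prodMk_nhds (tendsto_add_inv_sqrt_smul M x))
      have h3 := h2.norm_right
      have h4 : Tendsto (fun N : ℕ => √(N : ℝ) * (f (M + (√(N : ℝ))⁻¹ • z + (√(N : ℝ))⁻¹ • x) -
          f (M + (√(N : ℝ))⁻¹ • x) - fderiv ℝ f M ((√(N : ℝ))⁻¹ • z))) atTop (𝓝 0) := by
        have hO : (fun N : ℕ => √(N : ℝ) * ‖(√(N : ℝ))⁻¹ • z‖) =O[atTop]
            fun _ => (1 : ℝ) := by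
          refine Asymptotics.IsBigO.of_bound ‖z‖ ?_
          filter_upwards [eventually_ge_atTop 1] with N hN
          have := sqrt_pos hN
          rw [norm_mul, norm_norm, norm_smul, norm_inv, ← mul_assoc,
            mul_inv_cancel₀ (by simpa using this.ne')]
          simp
        rw [← Asymptotics.isLittleO_one_iff ℝ]
        refine Asymptotics.IsLittleO.trans_isBigO ?_ hO
        refine (Asymptotics.isBigO_refl (fun N : ℕ => √(N : ℝ)) atTop).mul_isLittleO ?_
        refine h3.congr (fun N => ?_) (fun N => ?_)
        · simp [Function.comp]
        · simp [Function.comp]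
      have h5 := h4.add_const (fderiv ℝ f M z)
      rw [zero_add] at h5
      refine h5.congr' ?_
      filter_upwards [eventually_ge_atTop 1] with N hN
      have := (sqrt_pos hN).ne'
      rw [map_smul, smul_eq_mul]
      field_simp
      ring
  · refine (norm_integral_le_of_norm_le_const (C := B) (ae_of_all _ fun x => hB _)).trans ?_
    simpa using le_abs_self B
  · rw [heq]
    refine (norm_integral_le_of_norm_le_const (C := K * ‖z‖)
      (ae_of_all _ fun x => hle N hN z x)).trans ?_
    simp only [probReal_univ, mul_one]
    gcongr
    linarith

/-! ### Expansion of the score of a tame prior -/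

/-- Near a point where it is `C²`, a nonnegative function agrees with a `C²` function of compact
support that lies between `0` and the given function. -/
lemma exists_contDiff_localization {π : Mat n p → ℝ} (h0 : ∀ θ, 0 ≤ π θ) {M : Mat n p}
    (hM : ContDiffAt ℝ 2 π M) : ∃ f : Mat n p → ℝ, ContDiff ℝ 2 f ∧ HasCompactSupport f ∧
      (∀ θ, 0 ≤ f θ) ∧ (∀ θ, f θ ≤ π θ) ∧ ∃ δ > 0, ∀ θ, ‖θ - M‖ < δ → f θ = π θ := by
  obtain ⟨r, hr, hball⟩ := Metric.eventually_nhds_iff_ball.1 (hM.eventually (by simp))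
  let χ : ContDiffBump M := ⟨r / 4, r / 2, by positivity, by linarith⟩
  refine ⟨fun θ => χ θ * π θ, ?_, χ.hasCompactSupport.mul_right,
    fun θ => mul_nonneg χ.nonneg (h0 θ), fun θ => mul_le_of_le_one_left (h0 θ) χ.le_one,
    r / 4, by positivity, fun θ hθ => ?_⟩
  · rw [contDiff_iff_contDiffAt]
    intro θ
    by_cases hθ : θ ∈ Metric.ball M r
    · exact χ.contDiff.contDiffAt.mul (hball θ hθ)
    · have hθ' : θ ∉ tsupport χ := by
        rw [χ.tsupport_eq, Metric.mem_closedBall]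
        rw [Metric.mem_ball] at hθ
        change ¬ dist θ M ≤ r / 2
        linarith
      have hev : (fun θ => χ θ * π θ) =ᶠ[𝓝 θ] fun _ => 0 := by
        filter_upwards [notMem_tsupport_iff_eventuallyEq.1 hθ'] with y hy
        rw [hy]; simp
      exact contDiffAt_const.congr_of_eventuallyEq hev
  · have : χ θ = 1 := χ.one_of_mem_closedBall (by
      rw [mem_closedBall_iff_norm]; exact hθ.le)
    dsimp only
    rw [this, one_mul]

lemma tendsto_mul_pow_mul_exp (C : ℝ) (k : ℕ) {ε : ℝ} (hε : 0 < ε) :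
    Tendsto (fun N : ℕ => C * (N : ℝ) ^ k * Real.exp (-(N * ε) / 8)) atTop (𝓝 0) := by
  have h := tendsto_pow_const_mul_const_pow_of_lt_one k (r := Real.exp (-(ε / 8)))
    (Real.exp_nonneg _) ((Real.exp_lt_exp.2 (by linarith)).trans_eq Real.exp_zero)
  have h2 := h.const_mul C
  rw [mul_zero] at h2
  refine h2.congr fun N => ?_
  rw [← Real.exp_nat_mul, mul_assoc]
  congr 3
  ring

/-- The partial derivative `∂f / ∂θ_{ai}`. -/
noncomputable def partialDeriv (f : Mat n p → ℝ) (a : Fin n) (i : Fin p) (θ : Mat n p) : ℝ :=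
  fderiv ℝ f θ (unitMat a i)

lemma contDiff_partialDeriv {f : Mat n p → ℝ} (hf : ContDiff ℝ 2 f) (a : Fin n) (i : Fin p) :
    ContDiff ℝ 1 (partialDeriv f a i) :=
  (hf.fderiv_right (m := 1) (by norm_num)).clm_apply contDiff_const

lemma hasCompactSupport_partialDeriv {f : Mat n p → ℝ} (hs : HasCompactSupport f) (a : Fin n)
    (i : Fin p) : HasCompactSupport (partialDeriv f a i) :=
  hs.fderiv_apply (𝕜 := ℝ) (unitMat a i)

/-- Stein's identity on the scale `1 / √N`. -/
lemma sqrt_mul_integral_entry_mul {f : Mat n p → ℝ} (hf : ContDiff ℝ 2 f) (hs : HasCompactSupport f)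
    {N : ℕ} (hN : 1 ≤ N) (Y : Mat n p) (a : Fin n) (i : Fin p) :
    √(N : ℝ) * ∫ x, x a i * f (Y + (√(N : ℝ))⁻¹ • x) ∂(stdLaw n p) =
      ∫ x, partialDeriv f a i (Y + (√(N : ℝ))⁻¹ • x) ∂(stdLaw n p) := by
  obtain ⟨B₁, hB₁⟩ := hf.continuous.bounded_above_of_compact_support hs
  obtain ⟨B₂, hB₂⟩ := (contDiff_partialDeriv hf a i).continuous.bounded_above_of_compact_support
    (hasCompactSupport_partialDeriv hs a i)
  have hsN := sqrt_pos hN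
  have hd : ∀ x, fderiv ℝ (fun x => f (Y + (√(N : ℝ))⁻¹ • x)) x (unitMat a i) =
      (√(N : ℝ))⁻¹ * partialDeriv f a i (Y + (√(N : ℝ))⁻¹ • x) := fun x => by
    have h1 : HasFDerivAt (fun x : Mat n p => Y + (√(N : ℝ))⁻¹ • x)
        ((√(N : ℝ))⁻¹ • ContinuousLinearMap.id ℝ (Mat n p)) x :=
      ((hasFDerivAt_id x).const_smul (√(N : ℝ))⁻¹).const_add Y
    have h2 : HasFDerivAt f (fderiv ℝ f (Y + (√(N : ℝ))⁻¹ • x)) (Y + (√(N : ℝ))⁻¹ • x) :=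
      (hf.differentiable two_ne_zero _).hasFDerivAt
    have h3 : HasFDerivAt (fun x => f (Y + (√(N : ℝ))⁻¹ • x)) _ x := h2.comp x h1
    rw [h3.fderiv]
    simp [partialDeriv]
  have h := stein (f := fun x => f (Y + (√(N : ℝ))⁻¹ • x)) (C := max B₁ B₂) (k := 0)
    ((hf.of_le one_le_two).comp (by fun_prop)) (fun x => by
      rw [pow_zero, mul_one]; exact (hB₁ _).trans (le_max_left _ _)) a i (fun x => by
      rw [hd, abs_mul, abs_of_pos (inv_pos.2 hsN), pow_zero, mul_one]
      exact (mul_le_of_le_one_left (abs_nonneg _) (inv_sqrt_le_one hN)).trans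
        ((hB₂ _).trans (le_max_right _ _)))
  simp_rw [hd] at h
  rw [h, integral_const_mul, ← mul_assoc, mul_inv_cancel₀ hsN.ne', one_mul]

namespace TamePrior

variable {π : Mat n p → ℝ}

/-- The part of a tame prior away from `M` contributes exponentially little near `M`. -/
lemma exists_tail_bound (hπ : TamePrior π) {f : Mat n p → ℝ} (hf : Measurable f)
    (hf0 : ∀ θ, 0 ≤ f θ) (hfπ : ∀ θ, f θ ≤ π θ) {M : Mat n p} {δ : ℝ} (hδ : 0 < δ)
    (hfM : ∀ θ, ‖θ - M‖ < δ → f θ = π θ) : ∃ τ : ℕ → ℝ, Tendsto τ atTop (𝓝 0) ∧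
      ∀ N : ℕ, 1 ≤ N → ∀ Y, ‖Y - M‖ ≤ δ / 2 →
        Integrable (fun x => (1 + ‖x‖) * (π - f) (Y + (√(N : ℝ))⁻¹ • x)) (stdLaw n p) ∧
        N * ∫ x, (1 + ‖x‖) * (π - f) (Y + (√(N : ℝ))⁻¹ • x) ∂(stdLaw n p) ≤ τ N := by
  obtain ⟨C, hC, h⟩ := hπ.integral_le 1
  refine ⟨_, tendsto_mul_pow_mul_exp C (n * p + 1) (ε := (δ / 2) ^ 2) (by positivity),
    fun N hN Y hY => ?_⟩
  obtain ⟨h1, h2⟩ := h N hN Y (π - f) (hπ.measurable.sub hf) (fun θ => sub_nonneg.2 (hfπ θ))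
    (fun θ => sub_le_self _ (hf0 θ)) ((δ / 2) ^ 2) fun θ hθ => by
      have h3 : δ ≤ ‖θ - M‖ := by
        by_contra! hlt
        exact hθ (sub_eq_zero.2 (hfM θ hlt).symm)
      have h4 : δ / 2 ≤ ‖θ - Y‖ := by
        have := norm_add_le (θ - Y) (Y - M)
        rw [sub_add_sub_cancel] at this
        linarith
      rw [frobLoss_eq_zero_sub]
      exact (pow_le_pow_left₀ (by positivity) h4 2).trans (norm_sq_le_frobLoss _)
  simp only [pow_one] at h1 h2
  refine ⟨h1, ?_⟩
  calc _ ≤ N * (C * (N : ℝ) ^ (n * p) * Real.exp (-(N * (δ / 2) ^ 2) / 8)) := by gcongr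
    _ = _ := by ring

/-- The score is expanded by moving the derivatives onto the smooth localization `f` of the
prior: up to exponentially small terms it is the quotient of the Gaussian averages of `∂f`
and `f`. -/
lemma exists_expandsAt_score (hπ : TamePrior π) {M : Mat n p} (hM : ContDiffAt ℝ 2 π M)
    (hM0 : 0 < π M) : ∃ f : Mat n p → ℝ, f =ᶠ[𝓝 M] π ∧ ∀ a i,
      ExpandsAt (fun N Y => score π N Y a i) M (partialDeriv f a i M / f M)
        (fun z => (fderiv ℝ (partialDeriv f a i) M z - partialDeriv f a i M / f M *
          fderiv ℝ f M z) / f M) := by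
  obtain ⟨f, hf, hfs, hf0, hfπ, δ, hδ, hfM⟩ := exists_contDiff_localization hπ.nonneg hM
  have hfm := hf.continuous.measurable
  obtain ⟨τ, hτ, htail⟩ := hπ.exists_tail_bound hfm hf0 hfπ hδ hfM
  have hfM' : f M = π M := hfM M (by simpa using hδ)
  refine ⟨f, ?_, fun a i => ?_⟩
  · filter_upwards [Metric.ball_mem_nhds M hδ] with θ hθ using hfM θ (mem_ball_iff_norm.1 hθ)
  have hdiff0 : ∀ θ, 0 ≤ (π - f) θ := fun θ => sub_nonneg.2 (hfπ θ)
  have hδ2 : 0 < δ / 2 := by positivity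
  obtain ⟨B, hB⟩ := hf.continuous.bounded_above_of_compact_support hfs
  have hfi : ∀ (N : ℕ) (Y : Mat n p), Integrable (fun x => f (Y + (√(N : ℝ))⁻¹ • x))
      (stdLaw n p) := fun N Y => Integrable.of_bound
        (measurable_shift hfm N Y).aestronglyMeasurable B (ae_of_all _ fun x => hB _)
  -- the marginal density
  have hD : ExpandsAt (fun N Y => ∫ x, π (Y + (√(N : ℝ))⁻¹ • x) ∂(stdLaw n p)) M (f M)
      (fun z => fderiv ℝ f M z) := by
    have h1 := (expandsAt_average (hf.of_le one_le_two) hfs M).add_small hδ2 hτ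
      (r := fun N Y => ∫ x, π (Y + (√(N : ℝ))⁻¹ • x) ∂(stdLaw n p) -
        ∫ x, f (Y + (√(N : ℝ))⁻¹ • x) ∂(stdLaw n p)) (fun N hN Y hY => by
        obtain ⟨hi, hb⟩ := htail N hN Y hY
        have hN1 : √(N : ℝ) ≤ N := by
          rw [Real.sqrt_le_left (by positivity)]
          have : (1 : ℝ) ≤ N := by exact_mod_cast hN
          nlinarith
        refine le_trans ?_ hb
        rw [← integral_sub (hπ.integrable_shift hN Y) (hfi N Y)]
        gcongr
        rw [← Real.norm_eq_abs]
        refine norm_integral_le_of_norm_le hi (ae_of_all _ fun x => ?_)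
        have h0 := hdiff0 (Y + (√(N : ℝ))⁻¹ • x)
        rw [← Pi.sub_apply, Real.norm_of_nonneg h0]
        exact le_mul_of_one_le_left h0 (by linarith [norm_nonneg x]))
    simpa using h1
  -- the numerator
  have hn : ExpandsAt (fun N Y => √(N : ℝ) * ∫ x, x a i * π (Y + (√(N : ℝ))⁻¹ • x) ∂(stdLaw n p)) M
      (partialDeriv f a i M) (fun z => fderiv ℝ (partialDeriv f a i) M z) := by
    have h1 := (expandsAt_average (contDiff_partialDeriv hf a i)
      (hasCompactSupport_partialDeriv hfs a i) M).add_small hδ2 hτ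
      (r := fun N Y => √(N : ℝ) * ∫ x, x a i * π (Y + (√(N : ℝ))⁻¹ • x) ∂(stdLaw n p) -
        ∫ x, partialDeriv f a i (Y + (√(N : ℝ))⁻¹ • x) ∂(stdLaw n p)) (fun N hN Y hY => by
        obtain ⟨hi, hb⟩ := htail N hN Y hY
        refine le_trans ?_ hb
        have hfi' : Integrable (fun x => x a i * f (Y + (√(N : ℝ))⁻¹ • x)) (stdLaw n p) :=
          (integrable_entry a i).mul_bdd (measurable_shift hfm N Y).aestronglyMeasurable
            (ae_of_all _ fun x => hB _)
        rw [← sqrt_mul_integral_entry_mul hf hfs hN, ← mul_sub, abs_mul,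
          abs_of_nonneg (Real.sqrt_nonneg _), ← mul_assoc, Real.mul_self_sqrt (by positivity),
          ← integral_sub (hπ.integrable_entry_mul_shift hN Y a i) hfi']
        gcongr
        rw [← Real.norm_eq_abs]
        refine norm_integral_le_of_norm_le hi (ae_of_all _ fun x => ?_)
        have h0 := hdiff0 (Y + (√(N : ℝ))⁻¹ • x)
        rw [← mul_sub, ← Pi.sub_apply, norm_mul, Real.norm_of_nonneg h0]
        gcongr
        rw [Real.norm_eq_abs]
        linarith [abs_entry_le_norm x a i])
    simpa using h1
  obtain ⟨c, hc, k, hle⟩ := hπ.le_marginal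
  have h2 := hn.div hD (hfM' ▸ hM0.ne') one_pos (c := c / (2 + ‖M‖) ^ k) (by positivity)
    (fun N hN Y hY => by
      have h3 := hle N hN Y
      rw [marginal_eq π hπ.measurable hN] at h3
      have h4 : ‖Y‖ ≤ 1 + ‖M‖ := by
        have := norm_add_le (Y - M) M
        rw [sub_add_cancel] at this
        linarith
      rw [div_le_iff₀ (by positivity)]
      have h5 : 1 + ‖Y‖ ≤ 2 + ‖M‖ := by linarith
      have h6 : 0 ≤ ∫ x, π (Y + (√(N : ℝ))⁻¹ • x) ∂(stdLaw n p) :=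
        integral_nonneg fun x => hπ.nonneg _
      exact h3.trans (by gcongr))
  -- `score` is this quotient only for `N ≥ 1`
  have heq : ∀ N, 1 ≤ N → ∀ Y, score π N Y a i =
      √(N : ℝ) * (∫ x, x a i * π (Y + (√(N : ℝ))⁻¹ • x) ∂(stdLaw n p)) /
        ∫ x, π (Y + (√(N : ℝ))⁻¹ • x) ∂(stdLaw n p) := fun N hN Y => by
    rw [score, marginal_eq π hπ.measurable hN]
  refine ⟨h2.center.congr' ?_, fun z => (h2.incr z).congr' ?_, ?_, ?_⟩
  · filter_upwards [eventually_ge_atTop 1] with N hN using (heq N hN M).symm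
  · filter_upwards [eventually_ge_atTop 1] with N hN
    rw [heq N hN, heq N hN]
  · obtain ⟨C, hC, h⟩ := h2.center_le
    exact ⟨C, hC, fun N hN => by rw [heq N hN]; exact h N hN⟩
  · obtain ⟨ε, hε, C, hC, h⟩ := h2.incr_le
    exact ⟨ε, hε, C, hC, fun N hN z hz => by rw [heq N hN, heq N hN]; exact h N hN z hz⟩

end TamePrior

/-! ### Second-order expansion of the risk -/

/-- The limit of `N² (R_N(δ_π, M) - np / N)`: with `Δ` and `∇` at `M`, it is
`2 Δπ / π - ‖∇π‖² / π² = 2 Δ log π + ‖∇ log π‖²`. -/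
noncomputable def riskLimit (π : Mat n p → ℝ) (M : Mat n p) : ℝ :=
  ∑ a, ∑ i, (2 * partialDeriv (partialDeriv π a i) a i M / π M - (partialDeriv π a i M / π M) ^ 2)

lemma partialDeriv_congr {f g : Mat n p → ℝ} {M : Mat n p} (h : f =ᶠ[𝓝 M] g) (a : Fin n)
    (i : Fin p) : partialDeriv f a i =ᶠ[𝓝 M] partialDeriv g a i := by
  filter_upwards [h.eventuallyEq_nhds] with θ hθ
  rw [partialDeriv, partialDeriv, hθ.fderiv_eq]

lemma riskLimit_congr {f g : Mat n p → ℝ} {M : Mat n p} (h : f =ᶠ[𝓝 M] g) :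
    riskLimit f M = riskLimit g M := by
  unfold riskLimit
  refine Finset.sum_congr rfl fun a _ => Finset.sum_congr rfl fun i _ => ?_
  have h1 := partialDeriv_congr h a i
  rw [(partialDeriv_congr h1 a i).eq_of_nhds, h1.eq_of_nhds, h.eq_of_nhds]

lemma sum_entry_smul_unitMat (z : Mat n p) : ∑ a, ∑ i, z a i • unitMat a i = z := by
  ext b j
  simp only [Finset.sum_apply, Pi.smul_apply, unitMat_apply, smul_eq_mul, mul_ite, mul_one,
    mul_zero]
  rw [Finset.sum_eq_single b (by intro c _ hc; simp [hc.symm]) (by simp),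
    Finset.sum_eq_single j (by intro c _ hc; simp [hc.symm]) (by simp)]
  simp

/-- For a linear form `L`, `E[Z_{ai} L(Z)] = L(E_{ai})`. -/
lemma integral_entry_mul_clm (L : Mat n p →L[ℝ] ℝ) (a : Fin n) (i : Fin p) :
    ∫ z, z a i * L z ∂(stdLaw n p) = L (unitMat a i) := by
  have h : ∀ z : Mat n p, z a i * L z = ∑ b, ∑ j, L (unitMat b j) * (z a i * z b j) := fun z => by
    conv_lhs => rw [← sum_entry_smul_unitMat z]
    simp only [map_sum, map_smul, smul_eq_mul, Finset.mul_sum]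
    rw [sum_entry_smul_unitMat]
    exact Finset.sum_congr rfl fun b _ => Finset.sum_congr rfl fun j _ => by ring
  simp_rw [h]
  rw [integral_finsetSum _ fun b _ => integrable_finsetSum _ fun j _ =>
    (integrable_entry_mul a b i j).const_mul _]
  simp_rw [integral_finsetSum _ fun j _ => (integrable_entry_mul a _ i j).const_mul _,
    integral_const_mul, integral_entry_mul]
  rw [Finset.sum_eq_single a (by intro c _ hc; simp [hc]) (by simp),
    Finset.sum_eq_single i (by intro c _ hc; simp [hc]) (by simp)]
  simp

namespace TamePrior

variable {π : Mat n p → ℝ}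

lemma exists_abs_score_shift_le (hπ : TamePrior π) (M : Mat n p) : ∃ C : ℝ, 0 ≤ C ∧ ∃ k : ℕ,
    ∀ N : ℕ, 1 ≤ N → ∀ (z : Mat n p) (a : Fin n) (i : Fin p),
      |score π N (M + (√(N : ℝ))⁻¹ • z) a i| ≤ C * N ^ k * (1 + ‖z‖) ^ k := by
  obtain ⟨C, hC, k, h⟩ := hπ.abs_score_le
  refine ⟨C * (1 + ‖M‖) ^ k, by positivity, n * p + 1 + k, fun N hN z a i => ?_⟩
  have hN1 : (1 : ℝ) ≤ N := by exact_mod_cast hN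
  have h1 : ‖M + (√(N : ℝ))⁻¹ • z‖ ≤ ‖M‖ + ‖z‖ := by
    refine (norm_add_le _ _).trans ?_
    gcongr
    rw [norm_smul, Real.norm_of_nonneg (by positivity)]
    exact mul_le_of_le_one_left (norm_nonneg _) (inv_sqrt_le_one hN)
  have h2 : 1 + ‖M + (√(N : ℝ))⁻¹ • z‖ ≤ (1 + ‖M‖) * (1 + ‖z‖) := by
    nlinarith [mul_nonneg (norm_nonneg M) (norm_nonneg z)]
  have h3 : (1 : ℝ) ≤ 1 + ‖z‖ := by linarith [norm_nonneg z]
  calc _ ≤ C * (N : ℝ) ^ (n * p + 1) * (1 + ‖M + (√(N : ℝ))⁻¹ • z‖) ^ k := h N hN _ a i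
    _ ≤ C * (N : ℝ) ^ (n * p + 1 + k) * ((1 + ‖M‖) * (1 + ‖z‖)) ^ k := by
        have := pow_le_pow_right₀ hN1 (show n * p + 1 ≤ n * p + 1 + k by omega)
        gcongr
    _ = C * (1 + ‖M‖) ^ k * (N : ℝ) ^ (n * p + 1 + k) * (1 + ‖z‖) ^ k := by rw [mul_pow]; ring
    _ ≤ _ := by
        have := pow_le_pow_right₀ h3 (show k ≤ n * p + 1 + k by omega)
        gcongr

lemma measurable_score_shift (hπ : TamePrior π) {N : ℕ} (hN : 1 ≤ N) (M : Mat n p) (a : Fin n)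
    (i : Fin p) : Measurable fun z : Mat n p => score π N (M + (√(N : ℝ))⁻¹ • z) a i :=
  (hπ.measurable_score hN a i).comp (by fun_prop)

lemma integrable_score_sq (hπ : TamePrior π) {N : ℕ} (hN : 1 ≤ N) (M : Mat n p) (a : Fin n)
    (i : Fin p) : Integrable (fun z => score π N (M + (√(N : ℝ))⁻¹ • z) a i ^ 2)
      (stdLaw n p) := by
  obtain ⟨C, hC, k, h⟩ := hπ.exists_abs_score_shift_le M
  refine integrable_of_le_pow (C := (C * N ^ k) ^ 2) (k := k * 2)
    ((hπ.measurable_score_shift hN M a i).pow_const 2).aestronglyMeasurable fun z => ?_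
  rw [abs_pow, pow_mul, ← mul_pow]
  exact pow_le_pow_left₀ (abs_nonneg _) (h N hN z a i) 2

lemma integrable_entry_mul_score (hπ : TamePrior π) {N : ℕ} (hN : 1 ≤ N) (M : Mat n p) (a : Fin n)
    (i : Fin p) : Integrable (fun z => z a i * score π N (M + (√(N : ℝ))⁻¹ • z) a i)
      (stdLaw n p) := by
  obtain ⟨C, hC, k, h⟩ := hπ.exists_abs_score_shift_le M
  refine integrable_of_le_pow (C := C * N ^ k) (k := k + 1)
    (Measurable.mul (f := fun z : Mat n p => z a i) (by fun_prop)
      (hπ.measurable_score_shift hN M a i)).aestronglyMeasurable fun z => ?_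
  rw [abs_mul]
  calc _ ≤ (1 + ‖z‖) * (C * N ^ k * (1 + ‖z‖) ^ k) := by
        gcongr
        · linarith [abs_entry_le_norm z a i]
        · exact h N hN z a i
    _ = _ := by ring

lemma frobLoss_genBayes (hπ : TamePrior π) {N : ℕ} (hN : 1 ≤ N) (M z : Mat n p) :
    frobLoss M (genBayes π N (M + (√(N : ℝ))⁻¹ • z)) = ∑ a, ∑ i,
      ((N : ℝ)⁻¹ * (z a i * z a i) + (2 * (√(N : ℝ))⁻¹ * (N : ℝ)⁻¹ *
        (z a i * score π N (M + (√(N : ℝ))⁻¹ • z) a i) +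
        ((N : ℝ)⁻¹) ^ 2 * score π N (M + (√(N : ℝ))⁻¹ • z) a i ^ 2)) := by
  unfold frobLoss
  refine Finset.sum_congr rfl fun a _ => Finset.sum_congr rfl fun i _ => ?_
  rw [hπ.genBayes_eq hN]
  have h2 : (N : ℝ)⁻¹ = (√(N : ℝ))⁻¹ ^ 2 := by
    rw [inv_pow, Real.sq_sqrt (by positivity)]
  simp only [Pi.add_apply, Pi.smul_apply, smul_eq_mul]
  generalize score π N (M + (√(N : ℝ))⁻¹ • z) a i = s
  rw [h2]
  ring

lemma measurable_frobLoss_genBayes (hπ : TamePrior π) (N : ℕ) (M : Mat n p) :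
    Measurable fun Y => frobLoss M (genBayes π N Y) :=
  (continuous_frobLoss.comp (by fun_prop : Continuous fun A : Mat n p => (M, A))).measurable.comp
    (hπ.measurable_genBayes N)

lemma integrable_risk_term (hπ : TamePrior π) {N : ℕ} (hN : 1 ≤ N) (M : Mat n p) (a : Fin n)
    (i : Fin p) : Integrable (fun z => (N : ℝ)⁻¹ * (z a i * z a i) +
      (2 * (√(N : ℝ))⁻¹ * (N : ℝ)⁻¹ * (z a i * score π N (M + (√(N : ℝ))⁻¹ • z) a i) +
        ((N : ℝ)⁻¹) ^ 2 * score π N (M + (√(N : ℝ))⁻¹ • z) a i ^ 2)) (stdLaw n p) :=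
  ((integrable_entry_mul a a i i).const_mul _).add
    (((hπ.integrable_entry_mul_score hN M a i).const_mul _).add
      ((hπ.integrable_score_sq hN M a i).const_mul _))

lemma finiteRisk (hπ : TamePrior π) {N : ℕ} (hN : 1 ≤ N) (M : Mat n p) :
    FiniteRisk N (genBayes π N) M := by
  rw [FiniteRisk, integrable_obsLaw_iff_stdLaw N M (hπ.measurable_frobLoss_genBayes N M)]
  simp_rw [hπ.frobLoss_genBayes hN]
  exact integrable_finsetSum _ fun a _ => integrable_finsetSum _ fun i _ =>
    hπ.integrable_risk_term hN M a i

/-- The scaled risk, relative to the risk `np / N` of the unbiased estimator `Y`. As `Z` has mean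
zero, the value of the score at `M` may be subtracted. -/
lemma sq_mul_risk_sub (hπ : TamePrior π) {N : ℕ} (hN : 1 ≤ N) (M : Mat n p) :
    (N : ℝ) ^ 2 * (risk N (genBayes π N) M - n * p / N) = ∑ a, ∑ i,
      (2 * ∫ z, z a i * (√(N : ℝ) * (score π N (M + (√(N : ℝ))⁻¹ • z) a i - score π N M a i))
        ∂(stdLaw n p) +
      ∫ z, score π N (M + (√(N : ℝ))⁻¹ • z) a i ^ 2 ∂(stdLaw n p)) := by
  have hN0 : (N : ℝ) ≠ 0 := by exact_mod_cast (by omega : N ≠ 0)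
  rw [risk, integral_obsLaw_eq_stdLaw N M (hπ.measurable_frobLoss_genBayes N M)]
  simp_rw [hπ.frobLoss_genBayes hN]
  rw [integral_finsetSum _ fun a _ => integrable_finsetSum _ fun i _ =>
    hπ.integrable_risk_term hN M a i]
  have hnp : (n * p / N : ℝ) = ∑ _a : Fin n, ∑ _i : Fin p, (N : ℝ)⁻¹ := by
    simp; ring
  rw [hnp, ← Finset.sum_sub_distrib, Finset.mul_sum]
  refine Finset.sum_congr rfl fun a _ => ?_
  rw [integral_finsetSum _ fun i _ => hπ.integrable_risk_term hN M a i,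
    ← Finset.sum_sub_distrib, Finset.mul_sum]
  refine Finset.sum_congr rfl fun i _ => ?_
  have h1 := hπ.integrable_entry_mul_score hN M a i
  have h2 := hπ.integrable_score_sq hN M a i
  rw [integral_add ((integrable_entry_mul a a i i).const_mul (N : ℝ)⁻¹)
    (g := fun z => 2 * (√(N : ℝ))⁻¹ * (N : ℝ)⁻¹ *
      (z a i * score π N (M + (√(N : ℝ))⁻¹ • z) a i) +
        ((N : ℝ)⁻¹) ^ 2 * score π N (M + (√(N : ℝ))⁻¹ • z) a i ^ 2)
    ((h1.const_mul _).add (h2.const_mul _)), integral_add (h1.const_mul _) (h2.const_mul _),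
    integral_const_mul, integral_const_mul, integral_const_mul, integral_entry_mul]
  have h3 : ∫ z, z a i * (√(N : ℝ) * (score π N (M + (√(N : ℝ))⁻¹ • z) a i - score π N M a i))
      ∂(stdLaw n p) = √(N : ℝ) * ∫ z, z a i * score π N (M + (√(N : ℝ))⁻¹ • z) a i
        ∂(stdLaw n p) := by
    have h4 : ∀ z : Mat n p,
        z a i * (√(N : ℝ) * (score π N (M + (√(N : ℝ))⁻¹ • z) a i - score π N M a i)) =
        √(N : ℝ) * (z a i * score π N (M + (√(N : ℝ))⁻¹ • z) a i) -
          √(N : ℝ) * score π N M a i * z a i := fun z => by ring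
    simp_rw [h4]
    rw [integral_sub (h1.const_mul _) ((integrable_entry a i).const_mul _), integral_const_mul,
      integral_const_mul, integral_entry, mul_zero, sub_zero]
  rw [h3]
  have hs := (sqrt_pos hN).ne'
  have h5 : (√(N : ℝ))⁻¹ = (N : ℝ)⁻¹ * √(N : ℝ) := by
    have hss : √(N : ℝ) ^ 2 = N := Real.sq_sqrt (by positivity)
    nth_rewrite 2 [← hss]; field_simp
  generalize ∫ z, z a i * score π N (M + (√(N : ℝ))⁻¹ • z) a i ∂(stdLaw n p) = I
  generalize ∫ z, score π N (M + (√(N : ℝ))⁻¹ • z) a i ^ 2 ∂(stdLaw n p) = J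
  rw [h5]
  simp only [and_self, if_true]
  field_simp
  ring

/-- Where `M + z / √N` leaves a fixed ball around `M`, one has `N ≤ C ‖z‖²`, so that bounds
polynomial in `N` become bounds polynomial in `z`. -/
lemma exists_global_bound (hπ : TamePrior π) {M : Mat n p} {a : Fin n} {i : Fin p} {v : ℝ}
    {L : Mat n p → ℝ} (hE : ExpandsAt (fun N Y => score π N Y a i) M v L) :
    ∃ C : ℝ, ∃ k : ℕ, ∀ N : ℕ, 1 ≤ N → ∀ z,
      |√(N : ℝ) * (score π N (M + (√(N : ℝ))⁻¹ • z) a i - score π N M a i)| ≤ C * (1 + ‖z‖) ^ k ∧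
      |score π N (M + (√(N : ℝ))⁻¹ • z) a i| ≤ C * (1 + ‖z‖) ^ k := by
  obtain ⟨ε₁, hε₁, C₁, hC₁, h1⟩ := hE.incr_le
  obtain ⟨ε₂, hε₂, C₂, hC₂, h2⟩ := hE.shift_le
  obtain ⟨C₃, hC₃, h3⟩ := hE.center_le
  obtain ⟨C₄, hC₄, k, h4⟩ := hπ.exists_abs_score_shift_le M
  set ε := min ε₁ ε₂ with hε
  have hε0 : 0 < ε := lt_min hε₁ hε₂
  set D := (1 / ε) ^ 2 with hD
  have hD0 : 0 ≤ D := by positivity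
  set m := 2 * k + k + 2 with hm
  -- far from the centre
  have hfar : ∀ N : ℕ, 1 ≤ N → ∀ z : Mat n p, ε * √(N : ℝ) < ‖z‖ →
      |score π N (M + (√(N : ℝ))⁻¹ • z) a i| ≤ C₄ * D ^ k * (1 + ‖z‖) ^ (2 * k + k) ∧
        √(N : ℝ) ≤ 1 / ε * (1 + ‖z‖) := by
    intro N hN z hz
    have hs : √(N : ℝ) ≤ 1 / ε * (1 + ‖z‖) := by
      rw [one_div, ← div_eq_inv_mul, le_div_iff₀ hε0]; linarith
    refine ⟨?_, hs⟩
    have hNle : (N : ℝ) ≤ D * (1 + ‖z‖) ^ 2 := by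
      rw [hD, ← mul_pow, ← Real.sq_sqrt (Nat.cast_nonneg N)]
      gcongr
    calc _ ≤ C₄ * (N : ℝ) ^ k * (1 + ‖z‖) ^ k := h4 N hN z a i
      _ ≤ C₄ * (D * (1 + ‖z‖) ^ 2) ^ k * (1 + ‖z‖) ^ k := by gcongr
      _ = _ := by rw [mul_pow, pow_add, pow_mul]; ring
  refine ⟨max C₁ C₂ + (1 / ε) * (C₄ * D ^ k + C₃) + C₄ * D ^ k, m, fun N hN z => ?_⟩
  have hz1 : (1 : ℝ) ≤ 1 + ‖z‖ := by linarith [norm_nonneg z]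
  have hpow : ∀ j, j ≤ m → (1 + ‖z‖) ^ j ≤ (1 + ‖z‖) ^ m := fun j hj => pow_le_pow_right₀ hz1 hj
  have hpm : 0 ≤ (1 + ‖z‖) ^ m := by positivity
  have hX : 0 ≤ C₄ * D ^ k := by positivity
  have hY : 0 ≤ (1 / ε) * (C₄ * D ^ k + C₃) := by positivity
  have hmax1 := le_max_left C₁ C₂
  have hmax2 := le_max_right C₁ C₂
  rcases le_or_gt ‖z‖ (ε * √(N : ℝ)) with hz | hz
  · refine ⟨(h1 N hN z (hz.trans (by gcongr; exact min_le_left _ _))).trans ?_,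
      (h2 N hN z (hz.trans (by gcongr; exact min_le_right _ _))).trans ?_⟩
    · have := hpow 1 (by omega)
      rw [pow_one] at this
      calc C₁ * (1 + ‖z‖) ≤ C₁ * (1 + ‖z‖) ^ m := by gcongr
        _ ≤ _ := by gcongr; linarith
    · have := hpow 0 (by omega)
      rw [pow_zero] at this
      calc C₂ ≤ C₂ * (1 + ‖z‖) ^ m := le_mul_of_one_le_right hC₂ this
        _ ≤ _ := by gcongr; linarith
  · obtain ⟨h5, h6⟩ := hfar N hN z hz
    constructor
    · rw [abs_mul, abs_of_nonneg (Real.sqrt_nonneg _)]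
      calc √(N : ℝ) * |score π N (M + (√(N : ℝ))⁻¹ • z) a i - score π N M a i|
          ≤ (1 / ε * (1 + ‖z‖)) * (C₄ * D ^ k * (1 + ‖z‖) ^ (2 * k + k) +
              C₃ * (1 + ‖z‖) ^ (2 * k + k)) := by
            gcongr
            refine (abs_sub _ _).trans (add_le_add h5 ((h3 N hN).trans ?_))
            exact le_mul_of_one_le_right hC₃ (one_le_pow₀ hz1)
        _ = (1 / ε) * (C₄ * D ^ k + C₃) * (1 + ‖z‖) ^ (2 * k + k + 1) := by ring
        _ ≤ (1 / ε) * (C₄ * D ^ k + C₃) * (1 + ‖z‖) ^ m := by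
            have := hpow (2 * k + k + 1) (by omega)
            gcongr
        _ ≤ _ := by gcongr; linarith
    · refine h5.trans ?_
      calc C₄ * D ^ k * (1 + ‖z‖) ^ (2 * k + k) ≤ C₄ * D ^ k * (1 + ‖z‖) ^ m := by
            have := hpow (2 * k + k) (by omega)
            gcongr
        _ ≤ _ := by gcongr; linarith

/-- The second-order expansion of the risk of a generalized Bayes estimator, at a point where the
prior is positive and `C²`. -/
theorem tendsto_sq_mul_risk_sub (hπ : TamePrior π) {M : Mat n p} (hM : ContDiffAt ℝ 2 π M)
    (hM0 : 0 < π M) :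
    Tendsto (fun N : ℕ => (N : ℝ) ^ 2 * (risk N (genBayes π N) M - n * p / N)) atTop
      (𝓝 (riskLimit π M)) := by
  obtain ⟨f, hf, hE⟩ := hπ.exists_expandsAt_score hM hM0
  rw [← riskLimit_congr hf]
  have hmain : Tendsto (fun N : ℕ => ∑ a, ∑ i,
      (2 * ∫ z, z a i * (√(N : ℝ) * (score π N (M + (√(N : ℝ))⁻¹ • z) a i - score π N M a i))
        ∂(stdLaw n p) +
      ∫ z, score π N (M + (√(N : ℝ))⁻¹ • z) a i ^ 2 ∂(stdLaw n p))) atTop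
      (𝓝 (riskLimit f M)) := by
    unfold riskLimit
    refine tendsto_finsetSum _ fun a _ => tendsto_finsetSum _ fun i _ => ?_
    obtain ⟨C, k, hb⟩ := hπ.exists_global_bound (hE a i)
    have hE := hE a i
    set v := partialDeriv f a i M / f M with hv
    let L : Mat n p →L[ℝ] ℝ :=
      (f M)⁻¹ • (fderiv ℝ (partialDeriv f a i) M - v • fderiv ℝ f M)
    have hL : ∀ z, (fderiv ℝ (partialDeriv f a i) M z - v * fderiv ℝ f M z) / f M = L z :=
      fun z => by simp [L, div_eq_inv_mul]
    have hlin : Tendsto (fun N : ℕ => ∫ z, z a i * (√(N : ℝ) *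
        (score π N (M + (√(N : ℝ))⁻¹ • z) a i - score π N M a i)) ∂(stdLaw n p)) atTop
        (𝓝 (∫ z, z a i * L z ∂(stdLaw n p))) := by
      refine tendsto_integral_filter_of_dominated_convergence
        (fun z => C * (1 + ‖z‖) ^ (k + 1)) ?_ ?_
        ((integrable_one_add_norm_pow _).const_mul C) (ae_of_all _ fun z => ?_)
      · filter_upwards [eventually_ge_atTop 1] with N hN
        exact (Measurable.mul (f := fun z : Mat n p => z a i) (by fun_prop)
          (((hπ.measurable_score_shift hN M a i).sub_const _).const_mul _)).aestronglyMeasurable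
      · filter_upwards [eventually_ge_atTop 1] with N hN
        refine ae_of_all _ fun z => ?_
        rw [norm_mul, Real.norm_eq_abs, Real.norm_eq_abs]
        calc _ ≤ (1 + ‖z‖) * (C * (1 + ‖z‖) ^ k) := by
              gcongr
              · linarith [abs_entry_le_norm z a i]
              · exact (hb N hN z).1
          _ = _ := by ring
      · rw [← hL]
        exact (hE.incr z).const_mul _
    have hsq : Tendsto (fun N : ℕ => ∫ z, score π N (M + (√(N : ℝ))⁻¹ • z) a i ^ 2
        ∂(stdLaw n p)) atTop (𝓝 (∫ _, v ^ 2 ∂(stdLaw n p))) := by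
      refine tendsto_integral_filter_of_dominated_convergence
        (fun z => C ^ 2 * (1 + ‖z‖) ^ (k * 2)) ?_ ?_
        ((integrable_one_add_norm_pow _).const_mul _) (ae_of_all _ fun z => ?_)
      · filter_upwards [eventually_ge_atTop 1] with N hN
        exact ((hπ.measurable_score_shift hN M a i).pow_const 2).aestronglyMeasurable
      · filter_upwards [eventually_ge_atTop 1] with N hN
        refine ae_of_all _ fun z => ?_
        rw [norm_pow, Real.norm_eq_abs, pow_mul, ← mul_pow]
        exact pow_le_pow_left₀ (abs_nonneg _) (hb N hN z).2 2
      · exact (hE.tendsto_shift z).pow 2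
    have h := (hlin.const_mul 2).add hsq
    rw [integral_entry_mul_clm, ← hL] at h
    convert h using 2
    have hfM : f M ≠ 0 := by rw [hf.eq_of_nhds]; exact hM0.ne'
    simp only [integral_const, probReal_univ, smul_eq_mul, one_mul]
    change 2 * partialDeriv (partialDeriv f a i) a i M / f M - v ^ 2 =
      2 * ((partialDeriv (partialDeriv f a i) a i M - v * partialDeriv f a i M) / f M) + v ^ 2
    rw [mul_div_assoc, sub_div, mul_div_assoc v, ← hv]
    ring
  refine hmain.congr' ?_
  filter_upwards [eventually_ge_atTop 1] with N hN using (hπ.sq_mul_risk_sub hN M).symm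

end TamePrior

/-! ### Uniform bounds for singular Gaussian integrals over columns -/

lemma exists_lintegral_abs_rpow_mul_exp_le {β : ℝ} (h0 : 0 ≤ β) (hβ : β < 1) :
    ∃ A : NNReal, ∀ y : ℝ,
      ∫⁻ t : ℝ, ENNReal.ofReal (|t| ^ (-β) * Real.exp (-(t - y) ^ 2 / 8)) ≤ A := by
  have h1 : IntervalIntegrable (fun t : ℝ => |t| ^ (-β)) volume 0 1 := by
    refine (intervalIntegral.intervalIntegrable_rpow' (a := 0) (b := 1)
      (r := -β) (by linarith)).congr fun t ht => ?_
    rw [Set.uIoc_of_le zero_le_one] at ht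
    simp only [abs_of_pos ht.1]
  have h2 : IntervalIntegrable (fun t : ℝ => |t| ^ (-β)) volume (-1) 0 := by
    rw [IntervalIntegrable.iff_comp_neg]
    simpa using h1.symm
  have h3 : IntegrableOn (fun t : ℝ => |t| ^ (-β)) (Set.Ioc (-1) 1) :=
    (intervalIntegrable_iff_integrableOn_Ioc_of_le (by norm_num)).1 (h2.trans h1)
  have h4 : Integrable fun t : ℝ => Real.exp (-(1 / 8) * t ^ 2) :=
    integrable_exp_neg_mul_sq (by norm_num)
  set I₁ := ∫⁻ t in Set.Ioc (-1 : ℝ) 1, ENNReal.ofReal (|t| ^ (-β)) with hI₁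
  set I₂ := ∫⁻ t : ℝ, ENNReal.ofReal (Real.exp (-(1 / 8) * t ^ 2)) with hI₂
  have hI₁t : I₁ ≠ ⊤ := by
    have := h3.2
    rw [hasFiniteIntegral_iff_ofReal (ae_of_all _ fun t => Real.rpow_nonneg (abs_nonneg t) _)]
      at this
    exact this.ne
  have hI₂t : I₂ ≠ ⊤ := by
    have := h4.2
    rw [hasFiniteIntegral_iff_ofReal (ae_of_all _ fun t => Real.exp_nonneg _)] at this
    exact this.ne
  refine ⟨(I₁ + I₂).toNNReal, fun y => ?_⟩
  rw [ENNReal.coe_toNNReal (ENNReal.add_ne_top.2 ⟨hI₁t, hI₂t⟩)]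
  have hshift : I₂ = ∫⁻ t : ℝ, ENNReal.ofReal (Real.exp (-(1 / 8) * (t - y) ^ 2)) :=
    (lintegral_sub_right_eq_self (fun t : ℝ => ENNReal.ofReal (Real.exp (-(1 / 8) * t ^ 2))) y).symm
  rw [hshift, hI₁, ← lintegral_indicator measurableSet_Ioc, ← lintegral_add_right _ (by fun_prop)]
  refine lintegral_mono fun t => ?_
  by_cases ht : t ∈ Set.Ioc (-1 : ℝ) 1
  · rw [Set.indicator_of_mem ht]
    refine le_add_right (ENNReal.ofReal_le_ofReal ?_)
    refine mul_le_of_le_one_right (Real.rpow_nonneg (abs_nonneg t) _) (Real.exp_le_one_iff.2 ?_)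
    nlinarith [sq_nonneg (t - y)]
  · refine le_add_left (ENNReal.ofReal_le_ofReal ?_)
    have ht1 : 1 ≤ |t| := by
      by_contra! hlt
      rw [abs_lt] at hlt
      exact ht ⟨hlt.1, hlt.2.le⟩
    have h5 : |t| ^ (-β) ≤ 1 := Real.rpow_le_one_of_one_le_of_nonpos ht1 (by linarith)
    calc _ ≤ 1 * Real.exp (-(t - y) ^ 2 / 8) := by gcongr
      _ = _ := by rw [one_mul]; congr 1; ring

/-- A singular Gaussian integral over `ℝⁿ` whose singularities along the coordinate hyperplanes
are all of order less than one. -/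
lemma exists_lintegral_prod_rpow_mul_exp_le {β : Fin n → ℝ} (h0 : ∀ j, 0 ≤ β j)
    (hβ : ∀ j, β j < 1) : ∃ A : NNReal, ∀ y : Fin n → ℝ,
      ∫⁻ x : Fin n → ℝ, ∏ j, ENNReal.ofReal (|x j| ^ (-β j) * Real.exp (-(x j - y j) ^ 2 / 8))
        ≤ A := by
  choose A hA using fun j => exists_lintegral_abs_rpow_mul_exp_le (h0 j) (hβ j)
  refine ⟨∏ j, A j, fun y => ?_⟩
  have hm : ∀ j, Measurable fun t : ℝ =>
      ENNReal.ofReal (|t| ^ (-β j) * Real.exp (-(t - y j) ^ 2 / 8)) := fun j => by fun_prop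
  rw [volume_pi, lintegral_fin_prod (fun _ => volume) hm]
  push_cast
  exact Finset.prod_le_prod' fun j _ => hA j (y j)

/-- A subspace of codimension at least `q` admits an orthonormal basis of `ℝⁿ` of which the first
`q` vectors are orthogonal to it. -/
lemma exists_orthonormalBasis_orthogonal {q : ℕ} (V : Submodule ℝ (EuclideanSpace ℝ (Fin n)))
    (hV : Module.finrank ℝ V + q ≤ n) : ∃ b : OrthonormalBasis (Fin n) ℝ (EuclideanSpace ℝ (Fin n)),
      ∀ j : Fin n, (j : ℕ) < q → b j ∈ Vᗮ := by
  have hq : q ≤ Module.finrank ℝ Vᗮ := by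
    have := V.finrank_add_finrank_orthogonal
    rw [finrank_euclideanSpace_fin] at this
    omega
  let u := stdOrthonormalBasis ℝ Vᗮ
  let v : Fin n → EuclideanSpace ℝ (Fin n) := fun j =>
    if h : (j : ℕ) < q then (u ⟨j, h.trans_le hq⟩ : EuclideanSpace ℝ (Fin n)) else 0
  have hv : Orthonormal ℝ (({j : Fin n | (j : ℕ) < q} : Set (Fin n)).domRestrict v) := by
    have h1 : Orthonormal ℝ fun k => (u k : EuclideanSpace ℝ (Fin n)) :=
      u.orthonormal.comp_linearIsometry Vᗮ.subtypeₗᵢ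
    have h2 := h1.comp (fun j : ({j : Fin n | (j : ℕ) < q} : Set (Fin n)) =>
      (⟨j.1, lt_of_lt_of_le j.2 hq⟩ : Fin (Module.finrank ℝ Vᗮ))) fun i j hij => by
        ext; simpa using hij
    convert h2 using 1
    ext1 j
    have : ((j : Fin n) : ℕ) < q := j.2
    simp [v, this]
  obtain ⟨b, hb⟩ := hv.exists_orthonormalBasis_extension_of_card_eq (by simp)
  refine ⟨b, fun j hj => ?_⟩
  rw [hb j hj]
  simp only [v, hj, dif_pos]
  exact (u _).2

/-- The integral over one column, uniformly in the span `V` of the other columns and in the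
centre `y`. The exponents `γ` and `n - p - 1` are distributed over the coordinates of a basis
adapted to `V`: each of the `n - p + 1` directions orthogonal to `V` receives a share of both, each
of the `p - 1` other ones a share of `γ` alone, and all coordinates get exponents less than one. -/
lemma exists_lintegral_column_le (hp : 1 ≤ p) (hn : p + 1 < n) {γ : ℝ} (h0 : 0 ≤ γ) (hγ : γ ≤ p) :
    ∃ A : NNReal, ∀ V : Submodule ℝ (EuclideanSpace ℝ (Fin n)), Module.finrank ℝ V + 1 ≤ p →
      ∀ y : EuclideanSpace ℝ (Fin n), ∫⁻ x : EuclideanSpace ℝ (Fin n), ENNReal.ofReal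
        (Real.exp (-‖x - y‖ ^ 2 / 8) * ‖x‖ ^ (-γ) *
          ‖x - V.starProjection x‖ ^ (-((n : ℝ) - p - 1))) ≤ A := by
  obtain ⟨q, hq⟩ : ∃ q, n = p + 1 + q := ⟨n - (p + 1), by omega⟩
  have hq1 : 1 ≤ q := by omega
  have hp0 : (1 : ℝ) ≤ p := by exact_mod_cast hp
  have hq0 : (1 : ℝ) ≤ q := by exact_mod_cast hq1
  have hnr : (n : ℝ) - p - 1 = q := by rw [hq]; push_cast; ring
  -- the shares of `γ` and of `q = n - p - 1`; the first `q + 2` directions are orthogonal to `V`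
  set α : Fin n → ℝ := fun j => if (j : ℕ) < q + 2 then 2 * γ / ((q + 2) * (p + 1)) else γ / (p + 1)
    with hα
  set δ : Fin n → ℝ := fun j => if (j : ℕ) < q + 2 then (q : ℝ) / (q + 2) else 0 with hδ
  have hcard1 : (Finset.univ.filter fun j : Fin n => (j : ℕ) < q + 2).card = q + 2 := by
    rw [Fin.card_filter_val_lt]; omega
  have hcard2 : (Finset.univ.filter fun j : Fin n => ¬ (j : ℕ) < q + 2).card = p - 1 := by
    have := Finset.card_filter_add_card_filter_not (s := (Finset.univ : Finset (Fin n)))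
      (fun j : Fin n => (j : ℕ) < q + 2)
    rw [hcard1, Finset.card_univ, Fintype.card_fin] at this
    omega
  have hαs : ∑ j, α j = γ := by
    simp only [hα]
    rw [Finset.sum_ite, Finset.sum_const, Finset.sum_const, hcard1, hcard2, nsmul_eq_mul,
      nsmul_eq_mul]
    push_cast [Nat.cast_sub hp]
    field_simp
    ring
  have hδs : ∑ j, δ j = q := by
    simp only [hδ]
    rw [Finset.sum_ite, Finset.sum_const, Finset.sum_const, hcard1, nsmul_eq_mul]
    push_cast
    field_simp
    simp
  have hα0 : ∀ j, 0 ≤ α j := fun j => by simp only [hα]; split_ifs <;> positivity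
  have hδ0 : ∀ j, 0 ≤ δ j := fun j => by simp only [hδ]; split_ifs <;> positivity
  have hlt : ∀ j, α j + δ j < 1 := fun j => by
    have h1 : γ / (p + 1) < 1 := by rw [div_lt_one (by positivity)]; linarith
    simp only [hα, hδ]
    split_ifs
    · have : 2 * γ / ((q + 2) * (p + 1)) + (q : ℝ) / (q + 2) = (2 * (γ / (p + 1)) + q) / (q + 2) := by
        field_simp
      rw [this, div_lt_one (by positivity)]
      linarith
    · linarith
  obtain ⟨A, hA⟩ := exists_lintegral_prod_rpow_mul_exp_le (β := fun j => α j + δ j)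
    (fun j => add_nonneg (hα0 j) (hδ0 j)) hlt
  refine ⟨A, fun V hV y => ?_⟩
  obtain ⟨b, hb⟩ := exists_orthonormalBasis_orthogonal (q := q + 2) V (by omega)
  set G : (Fin n → ℝ) → ENNReal := fun x =>
    ∏ j, ENNReal.ofReal (|x j| ^ (-(α j + δ j)) * Real.exp (-(x j - b.repr y j) ^ 2 / 8)) with hG
  have hGm : Measurable G := by
    refine Finset.measurable_prod _ fun j _ => Measurable.ennreal_ofReal ?_
    fun_prop
  have hmp : MeasurePreserving (fun x : EuclideanSpace ℝ (Fin n) => WithLp.ofLp (b.repr x))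
      volume volume :=
    (PiLp.volume_preserving_ofLp (Fin n)).comp b.measurePreserving_repr
  have hne : ∀ᵐ x : EuclideanSpace ℝ (Fin n), ∀ j, b.repr x j ≠ 0 := by
    refine hmp.quasiMeasurePreserving.ae (p := fun x : Fin n → ℝ => ∀ j, x j ≠ 0) ?_
    rw [ae_all_iff]
    intro j
    exact Measure.ae_eval_ne (fun _ : Fin n => (volume : Measure ℝ)) j 0
  have hcoord : ∀ (x : EuclideanSpace ℝ (Fin n)) j, |b.repr x j| ≤ ‖x‖ := fun x j => by
    rw [← b.repr.norm_map x]
    exact PiLp.norm_apply_le (b.repr x) j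
  have hcoordV : ∀ (x : EuclideanSpace ℝ (Fin n)) (j : Fin n), (j : ℕ) < q + 2 →
      |b.repr x j| ≤ ‖x - V.starProjection x‖ := fun x j hj => by
    have h1 : b.repr (V.starProjection x) j = 0 := by
      rw [b.repr_apply_apply, real_inner_comm]
      exact (hb j hj) _ (V.starProjection_apply_mem x)
    calc |b.repr x j| = |b.repr (x - V.starProjection x) j| := by
          rw [map_sub, PiLp.sub_apply, h1, sub_zero]
      _ ≤ _ := hcoord _ j
  calc ∫⁻ x, ENNReal.ofReal (Real.exp (-‖x - y‖ ^ 2 / 8) * ‖x‖ ^ (-γ) *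
          ‖x - V.starProjection x‖ ^ (-((n : ℝ) - p - 1)))
      ≤ ∫⁻ x : EuclideanSpace ℝ (Fin n), G (WithLp.ofLp (b.repr x)) := by
        refine lintegral_mono_ae ?_
        filter_upwards [hne] with x hx
        have hd : 0 < ‖x - V.starProjection x‖ :=
          (abs_pos.2 (hx ⟨0, by omega⟩)).trans_le (hcoordV x ⟨0, by omega⟩ (by simp))
        have hx0 : 0 < ‖x‖ := (abs_pos.2 (hx ⟨0, by omega⟩)).trans_le (hcoord x _)
        rw [hG]
        dsimp only
        rw [← ENNReal.ofReal_prod_of_nonneg fun j _ => by positivity]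
        refine ENNReal.ofReal_le_ofReal ?_
        have e1 : Real.exp (-‖x - y‖ ^ 2 / 8) =
            ∏ j, Real.exp (-(b.repr x j - b.repr y j) ^ 2 / 8) := by
          rw [← Real.exp_sum, ← b.repr.norm_map (x - y), EuclideanSpace.norm_sq_eq,
            ← Finset.sum_neg_distrib, Finset.sum_div]
          simp
        have e2 : ‖x‖ ^ (-γ) ≤ ∏ j, |b.repr x j| ^ (-α j) := by
          rw [← hαs, ← Finset.sum_neg_distrib, Real.rpow_sum_of_pos hx0]
          exact Finset.prod_le_prod (fun j _ => by positivity) fun j _ =>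
            Real.rpow_le_rpow_of_nonpos (abs_pos.2 (hx j)) (hcoord x j) (by linarith [hα0 j])
        have e3 : ‖x - V.starProjection x‖ ^ (-((n : ℝ) - p - 1)) ≤
            ∏ j, |b.repr x j| ^ (-δ j) := by
          rw [hnr, ← hδs, ← Finset.sum_neg_distrib, Real.rpow_sum_of_pos hd]
          refine Finset.prod_le_prod (fun j _ => by positivity) fun j _ => ?_
          by_cases hj : (j : ℕ) < q + 2
          · exact Real.rpow_le_rpow_of_nonpos (abs_pos.2 (hx j)) (hcoordV x j hj)
              (by linarith [hδ0 j])
          · simp [hδ, hj]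
        calc _ ≤ (∏ j, Real.exp (-(b.repr x j - b.repr y j) ^ 2 / 8)) *
              (∏ j, |b.repr x j| ^ (-α j)) * ∏ j, |b.repr x j| ^ (-δ j) := by
              rw [e1]; gcongr
          _ = _ := by
              rw [← Finset.prod_mul_distrib, ← Finset.prod_mul_distrib]
              refine Finset.prod_congr rfl fun j _ => ?_
              rw [neg_add, Real.rpow_add (abs_pos.2 (hx j))]
              ring
    _ = ∫⁻ x, G x := hmp.lintegral_comp hGm
    _ ≤ A := hA _

/-- Expansion of a Gram determinant along one vector: base times squared height. -/
lemma det_gram_cons {E : Type*} [NormedAddCommGroup E] [InnerProductSpace ℝ E]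
    [FiniteDimensional ℝ E] {m : ℕ} (x : E) (v : Fin m → E) :
    (Matrix.gram ℝ (Fin.cons x v : Fin (m + 1) → E)).det =
      (Matrix.gram ℝ v).det * ‖x - (Submodule.span ℝ (Set.range v)).starProjection x‖ ^ 2 := by
  set V := Submodule.span ℝ (Set.range v) with hV
  obtain ⟨c, hc⟩ := (Submodule.mem_span_range_iff_exists_fun ℝ).1 (V.starProjection_apply_mem x)
  set w := x - V.starProjection x with hw
  have hwV : w ∈ Vᗮ := V.sub_starProjection_mem_orthogonal x
  set A := Matrix.gram ℝ (Fin.cons x v : Fin (m + 1) → E) with hA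
  set c' : Fin (m + 1) → ℝ := Fin.cons 1 fun k => -c k with hc'
  -- subtracting from the first row a combination of the others replaces `x` by its height `w`
  have h1 := Matrix.det_updateRow_sum A 0 c'
  have hrow : ∑ k, c' k • A k = fun j => inner ℝ w ((Fin.cons x v : Fin (m + 1) → E) j) := by
    ext j
    have hws : w = ∑ k, c' k • (Fin.cons x v : Fin (m + 1) → E) k := by
      rw [Fin.sum_univ_succ, hw, ← hc]
      simp [hc', sub_eq_add_neg]
    rw [hws, sum_inner, Finset.sum_apply]
    refine Finset.sum_congr rfl fun k _ => ?_
    rw [real_inner_smul_left, Pi.smul_apply, smul_eq_mul, hA, Matrix.gram_apply]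
  have h2 : c' 0 • A.det = A.det := by simp [hc']
  rw [hrow, h2] at h1
  rw [← h1, Matrix.det_succ_row_zero, Finset.sum_eq_single 0]
  · have hsub : ((A.updateRow 0 fun j => inner ℝ w ((Fin.cons x v : Fin (m + 1) → E) j)).submatrix
        Fin.succ (Fin.succAbove 0)) = Matrix.gram ℝ v := by
      ext i j
      simp [Matrix.updateRow_apply, hA, Matrix.gram_apply]
    rw [hsub]
    have hwx : inner ℝ w x = ‖w‖ ^ 2 := by
      have h3 : inner ℝ w (V.starProjection x) = 0 := by
        rw [real_inner_comm]
        exact hwV _ (V.starProjection_apply_mem x)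
      rw [← real_inner_self_eq_norm_sq]
      nth_rewrite 3 [hw]
      rw [inner_sub_right, h3, sub_zero]
    simp [hwx]
    ring
  · intro j _ hj
    obtain ⟨k, rfl⟩ := Fin.exists_succ_eq.2 hj
    have : inner ℝ w (v k) = 0 := by
      rw [real_inner_comm]
      exact hwV _ (Submodule.subset_span ⟨k, rfl⟩)
    simp [this]
  · simp

lemma measurable_gram_det {m : ℕ} : Measurable fun X : Fin m → EuclideanSpace ℝ (Fin n) =>
    (Matrix.gram ℝ X).det := by
  refine Continuous.measurable (Continuous.matrix_det ?_)
  refine continuous_matrix fun i j => ?_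
  simp only [Matrix.gram_apply]
  fun_prop

lemma det_gram_nonneg {m : ℕ} (X : Fin m → EuclideanSpace ℝ (Fin n)) :
    0 ≤ (Matrix.gram ℝ X).det := (Matrix.posSemidef_gram ℝ X).det_nonneg

/-- The columns are integrated out one at a time, each with the span of the remaining ones
held fixed. -/
lemma lintegral_columns_le {m : ℕ} (hm : m ≤ p) {s : ℝ} (γ : Fin m → ℝ) (A : Fin m → NNReal)
    (hA : ∀ i, ∀ V : Submodule ℝ (EuclideanSpace ℝ (Fin n)), Module.finrank ℝ V + 1 ≤ p →
      ∀ y : EuclideanSpace ℝ (Fin n), ∫⁻ x : EuclideanSpace ℝ (Fin n), ENNReal.ofReal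
        (Real.exp (-‖x - y‖ ^ 2 / 8) * ‖x‖ ^ (-(γ i)) *
          ‖x - V.starProjection x‖ ^ (-s)) ≤ A i) (y : Fin m → EuclideanSpace ℝ (Fin n)) :
    ∫⁻ X : Fin m → EuclideanSpace ℝ (Fin n), ENNReal.ofReal
      ((∏ i, Real.exp (-‖X i - y i‖ ^ 2 / 8) * ‖X i‖ ^ (-(γ i))) *
        (Matrix.gram ℝ X).det ^ (-(s / 2))) ≤ ∏ i, (A i : ENNReal) := by
  induction m with
  | zero => simp [volume_pi]
  | succ m ih =>
    set F : ∀ k, (Fin k → ℝ) → (Fin k → EuclideanSpace ℝ (Fin n)) →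
        (Fin k → EuclideanSpace ℝ (Fin n)) → ℝ := fun k γ y X =>
      (∏ i, Real.exp (-‖X i - y i‖ ^ 2 / 8) * ‖X i‖ ^ (-(γ i))) *
        (Matrix.gram ℝ X).det ^ (-(s / 2)) with hF
    have hFm : ∀ k γ y, Measurable (F k γ y) := fun k γ y => by
      have := measurable_gram_det (n := n) (m := k)
      simp only [hF]
      refine Measurable.mul (Finset.measurable_prod _ fun i _ => ?_) (this.pow_const _)
      fun_prop
    have hF0 : ∀ k γ y X, 0 ≤ F k γ y X := fun k γ y X =>
      mul_nonneg (by positivity) (Real.rpow_nonneg (det_gram_nonneg X) _)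
    have hcons : ∀ (x : EuclideanSpace ℝ (Fin n)) (v : Fin m → EuclideanSpace ℝ (Fin n)),
        F (m + 1) γ y (Fin.cons x v) = F m (Fin.tail γ) (Fin.tail y) v *
          (Real.exp (-‖x - y 0‖ ^ 2 / 8) * ‖x‖ ^ (-(γ 0)) *
            ‖x - (Submodule.span ℝ (Set.range v)).starProjection x‖ ^ (-s)) := fun x v => by
      simp only [hF]
      rw [det_gram_cons, Real.mul_rpow (det_gram_nonneg v) (by positivity), Fin.prod_univ_succ,
        ← Real.rpow_natCast_mul (norm_nonneg _)]
      have : ((2 : ℕ) : ℝ) * -(s / 2) = -s := by push_cast; ring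
      rw [this]
      simp only [Fin.cons_zero, Fin.cons_succ, Fin.tail]
      ring
    change ∫⁻ X, ENNReal.ofReal (F (m + 1) γ y X) ≤ _
    have hmp := (volume_preserving_piFinSuccAbove
      (fun _ : Fin (m + 1) => EuclideanSpace ℝ (Fin n)) 0).symm
    have happ : ∀ z : EuclideanSpace ℝ (Fin n) × (Fin m → EuclideanSpace ℝ (Fin n)),
        (MeasurableEquiv.piFinSuccAbove (fun _ : Fin (m + 1) => EuclideanSpace ℝ (Fin n)) 0).symm z =
          Fin.cons z.1 z.2 := fun z => by
      simp [MeasurableEquiv.piFinSuccAbove_symm_apply, Fin.insertNthEquiv]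
    have hcm : Measurable fun z : EuclideanSpace ℝ (Fin n) × (Fin m → EuclideanSpace ℝ (Fin n)) =>
        ENNReal.ofReal (F (m + 1) γ y (Fin.cons z.1 z.2)) := by
      have := ((hFm (m + 1) γ y).ennreal_ofReal).comp hmp.measurable
      convert this using 2 with z
      simp only [Function.comp, happ]
    rw [← hmp.lintegral_comp (hFm _ _ _).ennreal_ofReal]
    simp_rw [happ]
    rw [Measure.volume_eq_prod, lintegral_prod_symm _ hcm.aemeasurable, Fin.prod_univ_succ]
    calc ∫⁻ v : Fin m → EuclideanSpace ℝ (Fin n), ∫⁻ x : EuclideanSpace ℝ (Fin n),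
          ENNReal.ofReal (F (m + 1) γ y (Fin.cons x v))
        ≤ ∫⁻ v, A 0 * ENNReal.ofReal (F m (Fin.tail γ) (Fin.tail y) v) := by
          refine lintegral_mono fun v => ?_
          simp_rw [hcons, ENNReal.ofReal_mul (hF0 m _ _ v)]
          rw [lintegral_const_mul' _ _ ENNReal.ofReal_ne_top, mul_comm]
          gcongr
          refine hA 0 _ ?_ (y 0)
          have := finrank_range_le_card (R := ℝ) v
          rw [Fintype.card_fin] at this
          unfold Set.finrank at this
          omega
      _ = A 0 * ∫⁻ v, ENNReal.ofReal (F m (Fin.tail γ) (Fin.tail y) v) :=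
          lintegral_const_mul' _ _ ENNReal.coe_ne_top
      _ ≤ _ := by
          gcongr
          exact ih (by omega) (Fin.tail γ) (fun i => A i.succ) (fun i => hA i.succ) (Fin.tail y)

/-! ### The two priors are tame -/

/-- The columns of a matrix, as vectors of a Euclidean space. -/
def columns (n p : ℕ) : Mat n p ≃ₗ[ℝ] (Fin p → EuclideanSpace ℝ (Fin n)) where
  toFun M := fun i => WithLp.toLp 2 fun a => M a i
  invFun X := fun a i => X i a
  left_inv _ := rfl
  right_inv _ := rfl
  map_add' _ _ := rfl
  map_smul' _ _ := rfl

lemma columns_apply (M : Mat n p) (i : Fin p) (a : Fin n) : columns n p M i a = M a i := rfl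

lemma colNorm_eq (M : Mat n p) (i : Fin p) : colNorm M i = ‖columns n p M i‖ := rfl

lemma gram_columns (M : Mat n p) :
    Matrix.gram ℝ (columns n p M) = (Matrix.of M).transpose * Matrix.of M := by
  ext i j
  rw [Matrix.gram_apply, Matrix.mul_apply, PiLp.inner_apply]
  refine Finset.sum_congr rfl fun a _ => ?_
  simp [columns_apply, mul_comm]

lemma frobLoss_eq_sum_columns (M A : Mat n p) :
    frobLoss M A = ∑ i, ‖columns n p A i - columns n p M i‖ ^ 2 := by
  unfold frobLoss
  rw [Finset.sum_comm]
  refine Finset.sum_congr rfl fun i _ => ?_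
  rw [EuclideanSpace.norm_sq_eq]
  refine Finset.sum_congr rfl fun a _ => ?_
  simp [columns_apply]

lemma priorSVS_eq (M : Mat n p) : priorSVS M =
    (Matrix.gram ℝ (columns n p M)).det ^ (-(((n : ℝ) - p - 1) / 2)) := by
  rw [gram_columns, priorSVS]

lemma priorMSVS2_zero : priorMSVS2 (n := n) (0 : Fin p → ℝ) = priorSVS := by
  ext M; simp [priorMSVS2]

lemma continuous_columns : Continuous (columns n p) :=
  (columns n p).toLinearMap.continuous_of_finiteDimensional

/-- Lebesgue measure on matrices is, up to a constant, the product of the Lebesgue measures on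
the columns. -/
lemma exists_lintegral_columns_comp_eq : ∃ c : NNReal,
    ∀ f : (Fin p → EuclideanSpace ℝ (Fin n)) → ENNReal, Measurable f →
      ∫⁻ M, f (columns n p M) = c * ∫⁻ X, f X := by
  let e := (columns n p).toContinuousLinearEquiv
  have : (Measure.map e (volume : Measure (Mat n p))).IsAddHaarMeasure :=
    e.isAddHaarMeasure_map _
  refine ⟨Measure.addHaarScalarFactor (Measure.map e (volume : Measure (Mat n p)))
    (volume : Measure (Fin p → EuclideanSpace ℝ (Fin n))), fun f hf => ?_⟩
  have h := Measure.isAddLeftInvariant_eq_smul (Measure.map e (volume : Measure (Mat n p)))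
    (volume : Measure (Fin p → EuclideanSpace ℝ (Fin n)))
  calc ∫⁻ M, f (columns n p M) = ∫⁻ X, f X ∂(Measure.map e (volume : Measure (Mat n p))) :=
        (lintegral_map hf e.continuous.measurable).symm
    _ = _ := by
      conv_lhs => rw [h]
      rw [lintegral_smul_measure]
      rfl

lemma priorMSVS2_nonneg (γ : Fin p → ℝ) (M : Mat n p) : 0 ≤ priorMSVS2 γ M := by
  rw [priorMSVS2, priorSVS_eq]
  refine mul_nonneg (Real.rpow_nonneg (det_gram_nonneg _) _) (Finset.prod_nonneg fun i _ => ?_)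
  exact Real.rpow_nonneg (norm_nonneg _) _

lemma measurable_priorMSVS2 (γ : Fin p → ℝ) : Measurable (priorMSVS2 (n := n) γ) := by
  have hc := (continuous_columns (n := n) (p := p)).measurable
  have h1 : Measurable (priorSVS (n := n) (p := p)) := by
    simp_rw [funext priorSVS_eq]
    exact (measurable_gram_det.comp hc).pow_const _
  refine h1.mul (Finset.measurable_prod _ fun i _ => Measurable.pow_const ?_ _)
  simp_rw [colNorm_eq]
  exact ((measurable_pi_apply i).comp hc).norm

lemma colNorm_pos {M : Mat n p} (h : (Matrix.gram ℝ (columns n p M)).det ≠ 0) (i : Fin p) :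
    0 < colNorm M i := by
  rw [colNorm_eq, norm_pos_iff]
  exact (Matrix.linearIndependent_of_det_gram_ne_zero h).ne_zero i

/-- The Gram determinant is almost everywhere positive: on each line in the direction of the
matrix with columns `e₁, …, e_p`, the top `p × p` block is singular only at finitely many points,
as these are the roots of a characteristic polynomial. -/
lemma ae_det_gram_pos (hpn : p ≤ n) :
    ∀ᵐ M : Mat n p, 0 < (Matrix.gram ℝ (columns n p M)).det := by
  have hms : MeasurableSet {M : Mat n p | 0 < (Matrix.gram ℝ (columns n p M)).det} :=
    measurableSet_lt measurable_const (measurable_gram_det.comp continuous_columns.measurable)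
  let E : Mat n p := fun a i => if a = Fin.castLE hpn i then 1 else 0
  refine ae_mem_of_ae_add_linearMap_mem (LinearMap.toSpanSingleton ℝ (Mat n p) E)
    (volume : Measure ℝ) volume hms fun M => ?_
  let B : Matrix (Fin p) (Fin p) ℝ := Matrix.of fun j i => -M (Fin.castLE hpn j) i
  have hfin : {t : ℝ | B.charpoly.eval t = 0}.Finite := by
    refine (B.charpoly.roots.toFinset.finite_toSet).subset fun t ht => ?_
    simpa [B.charpoly_monic.ne_zero] using ht
  have hae : ∀ᵐ t : ℝ, t ∉ {t : ℝ | B.charpoly.eval t = 0} := by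
    rw [ae_iff]; simpa using hfin.measure_zero volume
  filter_upwards [hae] with t ht
  refine lt_of_le_of_ne (det_gram_nonneg _) fun h0 => ht ?_
  have hli : ¬ LinearIndependent ℝ (columns n p (M + t • E)) := fun hli =>
    Matrix.det_gram_ne_zero_iff_linearIndependent.2 hli h0.symm
  rw [Fintype.not_linearIndependent_iff] at hli
  obtain ⟨c, hc, i, hi⟩ := hli
  rw [Matrix.eval_charpoly, ← Matrix.exists_mulVec_eq_zero_iff]
  refine ⟨c, fun h => hi (congrFun h i), ?_⟩
  ext j
  have h1 := congrArg (fun v : EuclideanSpace ℝ (Fin n) => v (Fin.castLE hpn j)) hc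
  simp only [WithLp.ofLp_sum, Finset.sum_apply, PiLp.smul_apply, columns_apply, PiLp.zero_apply,
    Pi.add_apply, Pi.smul_apply, smul_eq_mul] at h1
  rw [Pi.zero_apply, ← h1, Matrix.mulVec, dotProduct]
  refine Finset.sum_congr rfl fun k _ => ?_
  simp only [Matrix.sub_apply, Matrix.scalar_apply, Matrix.diagonal_apply, B, E, Matrix.of_apply,
    (Fin.castLE_injective hpn).eq_iff]
  split_ifs <;> ring

lemma colNorm_le (M : Mat n p) (i : Fin p) : colNorm M i ≤ n * (1 + ‖M‖) := by
  refine abs_le_of_sq_le_sq' ?_ (by positivity) |>.2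
  rw [colNorm, EuclideanSpace.norm_sq_eq]
  calc ∑ a, ‖M a i‖ ^ 2 ≤ ∑ _a : Fin n, (1 + ‖M‖) ^ 2 := by
        refine Finset.sum_le_sum fun a _ => pow_le_pow_left₀ (norm_nonneg _) ?_ 2
        have := abs_entry_le_norm M a i
        rw [Real.norm_eq_abs]; linarith
    _ = n * (1 + ‖M‖) ^ 2 := by simp
    _ ≤ (n : ℝ) ^ 2 * (1 + ‖M‖) ^ 2 := by
        gcongr
        exact_mod_cast Nat.le_self_pow two_ne_zero n
    _ = _ := by ring

lemma det_gram_le (hp : 1 ≤ p) (M : Mat n p) :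
    (Matrix.gram ℝ (columns n p M)).det ≤ (p.factorial * n * (1 + ‖M‖)) ^ (2 * p) := by
  have h1 : ∀ i j, AbsoluteValue.abs (Matrix.gram ℝ (columns n p M) i j) ≤
      (n * (1 + ‖M‖)) ^ 2 := fun i j => by
    rw [Matrix.gram_apply, sq]
    exact (abs_real_inner_le_norm _ _).trans (mul_le_mul (colNorm_le M i) (colNorm_le M j)
      (norm_nonneg _) (by positivity))
  have h2 := (le_abs_self _).trans (Matrix.det_le h1)
  rw [Fintype.card_fin, nsmul_eq_mul] at h2
  refine h2.trans ?_
  have h3 : (1 : ℝ) ≤ p.factorial := by exact_mod_cast p.factorial_pos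
  calc (p.factorial : ℝ) * ((n * (1 + ‖M‖)) ^ 2) ^ p
      ≤ (p.factorial : ℝ) ^ (2 * p) * ((n * (1 + ‖M‖)) ^ 2) ^ p := by
        gcongr
        exact le_self_pow₀ h3 (by omega)
    _ = _ := by rw [← pow_mul, ← mul_pow, mul_assoc]

/-- Off the null set of rank-deficient matrices, the prior is a product of negative powers of
polynomially bounded quantities. -/
lemma priorMSVS2_lower (hp : 1 ≤ p) (hn : p + 1 < n) {γ : Fin p → ℝ} (hγ : ∀ i, 0 ≤ γ i) :
    ∃ c > 0, ∃ k : ℕ, ∀ᵐ θ : Mat n p, c ≤ priorMSVS2 γ θ * (1 + ‖θ‖) ^ k := by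
  have hnr : 0 < (n : ℝ) - p - 1 := by
    have : ((p + 1 : ℕ) : ℝ) < n := by exact_mod_cast hn
    push_cast at this; linarith
  set s := (n : ℝ) - p - 1 with hs
  set B : ℝ := p.factorial * n with hB
  have hn1 : (1 : ℝ) ≤ n := by exact_mod_cast (by omega : 1 ≤ n)
  have hf1 : (1 : ℝ) ≤ p.factorial := by exact_mod_cast p.factorial_pos
  have hB1 : 1 ≤ B := one_le_mul_of_one_le_of_one_le hf1 hn1
  set e := p * s + ∑ i, γ i with he
  refine ⟨(B ^ ⌈e⌉₊)⁻¹, by positivity, ⌈e⌉₊, ?_⟩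
  filter_upwards [ae_det_gram_pos (by omega : p ≤ n)] with M hM
  set T := B * (1 + ‖M‖) with hT
  have hR1 : 1 ≤ 1 + ‖M‖ := by linarith [norm_nonneg M]
  have hT1 : 1 ≤ T := one_le_mul_of_one_le_of_one_le hB1 hR1
  have hT0 : 0 < T := by positivity
  have h1 : T ^ (-(p * s)) ≤ priorSVS M := by
    rw [priorSVS_eq]
    calc T ^ (-(p * s)) = (T ^ (2 * p)) ^ (-(s / 2)) := by
          rw [← Real.rpow_natCast_mul hT0.le]; congr 1; push_cast; ring
      _ ≤ _ := Real.rpow_le_rpow_of_nonpos hM (det_gram_le hp M) (by linarith)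
  have h2 : ∏ i, T ^ (-(γ i)) ≤ ∏ i, colNorm M i ^ (-(γ i)) := by
    refine Finset.prod_le_prod (fun i _ => by positivity) fun i _ => ?_
    refine Real.rpow_le_rpow_of_nonpos (colNorm_pos hM.ne' i) ((colNorm_le M i).trans ?_)
      (by linarith [hγ i])
    rw [hT, hB, mul_assoc]
    exact le_mul_of_one_le_left (by positivity) hf1
  have h3 : (T ^ ⌈e⌉₊)⁻¹ ≤ priorMSVS2 γ M := by
    calc (T ^ ⌈e⌉₊)⁻¹ = T ^ (-(⌈e⌉₊ : ℝ)) := by rw [Real.rpow_neg hT0.le, Real.rpow_natCast]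
      _ ≤ T ^ (-e) := Real.rpow_le_rpow_of_exponent_le hT1 (neg_le_neg (Nat.le_ceil e))
      _ = T ^ (-(p * s)) * ∏ i, T ^ (-(γ i)) := by
          rw [← Real.rpow_sum_of_pos hT0, ← Real.rpow_add hT0, he, Finset.sum_neg_distrib]
          congr 1; ring
      _ ≤ _ := by
          rw [priorMSVS2]
          gcongr
          rw [priorSVS_eq]
          exact Real.rpow_nonneg hM.le _
  calc (B ^ ⌈e⌉₊)⁻¹ = (T ^ ⌈e⌉₊)⁻¹ * (1 + ‖M‖) ^ ⌈e⌉₊ := by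
        rw [hT, mul_pow B, mul_inv, mul_assoc, inv_mul_cancel₀ (by positivity), mul_one]
    _ ≤ _ := by gcongr

lemma priorMSVS2_upper (hp : 1 ≤ p) (hn : p + 1 < n) {γ : Fin p → ℝ}
    (hγ : ∀ i, 0 ≤ γ i ∧ γ i ≤ p) : ∃ A : NNReal, ∀ Y : Mat n p,
      ∫⁻ θ, ENNReal.ofReal (Real.exp (-frobLoss Y θ / 8) * priorMSVS2 γ θ) ≤ A := by
  choose A hA using fun i => exists_lintegral_column_le hp hn (hγ i).1 (hγ i).2
  obtain ⟨c, hc⟩ := exists_lintegral_columns_comp_eq (n := n) (p := p)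
  refine ⟨c * ∏ i, A i, fun Y => ?_⟩
  set f : (Fin p → EuclideanSpace ℝ (Fin n)) → ENNReal := fun X => ENNReal.ofReal
      ((∏ i, Real.exp (-‖X i - columns n p Y i‖ ^ 2 / 8) * ‖X i‖ ^ (-(γ i))) *
        (Matrix.gram ℝ X).det ^ (-(((n : ℝ) - p - 1) / 2))) with hf
  have hfm : Measurable f := by
    refine Measurable.ennreal_ofReal (Measurable.mul (Finset.measurable_prod _ fun i _ => ?_)
      (measurable_gram_det.pow_const _))
    fun_prop
  calc _ = ∫⁻ θ, f (columns n p θ) := by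
        refine lintegral_congr fun θ => ?_
        simp only [hf]
        congr 1
        rw [priorMSVS2, priorSVS_eq, frobLoss_eq_sum_columns, ← Finset.sum_neg_distrib,
          Finset.sum_div, Real.exp_sum, Finset.prod_mul_distrib]
        simp_rw [colNorm_eq]
        ring
    _ = c * ∫⁻ X, f X := hc f hfm
    _ ≤ c * ∏ i, (A i : ENNReal) := by
        gcongr
        exact lintegral_columns_le le_rfl γ A hA (columns n p Y)
    _ = _ := by push_cast; rfl

lemma tamePrior_priorMSVS2 (hp : 1 ≤ p) (hn : p + 1 < n) {γ : Fin p → ℝ}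
    (hγ : ∀ i, 0 ≤ γ i ∧ γ i ≤ p) : TamePrior (priorMSVS2 (n := n) γ) where
  measurable := measurable_priorMSVS2 γ
  nonneg := priorMSVS2_nonneg γ
  lower := priorMSVS2_lower hp hn fun i => (hγ i).1
  upper := priorMSVS2_upper hp hn hγ

lemma tamePrior_priorSVS (hp : 1 ≤ p) (hn : p + 1 < n) :
    TamePrior (priorSVS (n := n) (p := p)) := by
  rw [← priorMSVS2_zero]
  exact tamePrior_priorMSVS2 hp hn fun i => ⟨le_rfl, Nat.cast_nonneg p⟩

/-! ### The difference of the two risk limits -/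

lemma contDiffAt_partialDeriv {f : Mat n p → ℝ} {M : Mat n p} (hf : ContDiffAt ℝ 2 f M) (a : Fin n)
    (i : Fin p) : ContDiffAt ℝ 1 (partialDeriv f a i) M :=
  (hf.fderiv_right (m := 1) (by norm_num)).clm_apply contDiffAt_const

lemma partialDeriv_mul {f g : Mat n p → ℝ} {M : Mat n p} (hf : DifferentiableAt ℝ f M)
    (hg : DifferentiableAt ℝ g M) (a : Fin n) (i : Fin p) :
    partialDeriv (f * g) a i M = partialDeriv f a i M * g M + f M * partialDeriv g a i M := by
  unfold partialDeriv
  rw [fderiv_mul hf hg]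
  simp only [add_apply, smul_apply, smul_eq_mul]
  ring

lemma partialDeriv_partialDeriv_mul {f g : Mat n p → ℝ} {M : Mat n p} (hf : ContDiffAt ℝ 2 f M)
    (hg : ContDiffAt ℝ 2 g M) (a : Fin n) (i : Fin p) :
    partialDeriv (partialDeriv (f * g) a i) a i M =
      partialDeriv (partialDeriv f a i) a i M * g M +
        2 * (partialDeriv f a i M * partialDeriv g a i M) +
        f M * partialDeriv (partialDeriv g a i) a i M := by
  have hev : partialDeriv (f * g) a i =ᶠ[𝓝 M]
      partialDeriv f a i * g + f * partialDeriv g a i := by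
    filter_upwards [hf.eventually (by simp), hg.eventually (by simp)] with θ h1 h2
    exact partialDeriv_mul (h1.differentiableAt two_ne_zero) (h2.differentiableAt two_ne_zero) a i
  have d1 := (contDiffAt_partialDeriv hf a i).differentiableAt one_ne_zero
  have d2 := (contDiffAt_partialDeriv hg a i).differentiableAt one_ne_zero
  have d3 := hf.differentiableAt two_ne_zero
  have d4 := hg.differentiableAt two_ne_zero
  have hadd : partialDeriv (partialDeriv f a i * g + f * partialDeriv g a i) a i M =
      partialDeriv (partialDeriv f a i * g) a i M +
        partialDeriv (f * partialDeriv g a i) a i M := by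
    rw [partialDeriv, fderiv_add (d1.mul d4) (d3.mul d2)]
    rfl
  rw [(partialDeriv_congr hev a i).eq_of_nhds, hadd, partialDeriv_mul d1 d4, partialDeriv_mul d3 d2]
  ring

lemma riskLimit_mul {f g : Mat n p → ℝ} {M : Mat n p} (hf : ContDiffAt ℝ 2 f M)
    (hg : ContDiffAt ℝ 2 g M) (hf0 : f M ≠ 0) (hg0 : g M ≠ 0) :
    riskLimit (f * g) M = riskLimit f M + riskLimit g M +
      2 * ∑ a, ∑ i, partialDeriv f a i M / f M * (partialDeriv g a i M / g M) := by
  unfold riskLimit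
  simp_rw [Finset.mul_sum, ← Finset.sum_add_distrib]
  refine Finset.sum_congr rfl fun a _ => Finset.sum_congr rfl fun i _ => ?_
  rw [partialDeriv_partialDeriv_mul hf hg, partialDeriv_mul (hf.differentiableAt two_ne_zero)
    (hg.differentiableAt two_ne_zero), Pi.mul_apply]
  field_simp
  ring

/-- A partial derivative is the derivative along the line in the direction of the matrix unit. -/
lemma partialDeriv_eq_of_hasDerivAt {f : Mat n p → ℝ} {M : Mat n p} (hf : DifferentiableAt ℝ f M)
    {a : Fin n} {i : Fin p} {d : ℝ} (hd : HasDerivAt (fun t : ℝ => f (M + t • unitMat a i)) d 0) :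
    partialDeriv f a i M = d := by
  have h1 : HasDerivAt (fun t : ℝ => M + t • unitMat a i) (unitMat a i) 0 := by
    simpa using ((hasDerivAt_id (0 : ℝ)).smul_const (unitMat a i : Mat n p)).const_add M
  have h2 : HasFDerivAt f (fderiv ℝ f M) (M + (0 : ℝ) • unitMat a i) := by
    simpa using hf.hasFDerivAt
  exact (h2.comp_hasDerivAt 0 h1).unique hd

lemma colNorm_sq (M : Mat n p) (i : Fin p) : colNorm M i ^ 2 = ∑ a, M a i ^ 2 := by
  rw [colNorm, EuclideanSpace.norm_sq_eq]
  simp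

lemma colNorm_sq_add_smul (M : Mat n p) (a : Fin n) (i j : Fin p) (t : ℝ) :
    colNorm (M + t • unitMat a i) j ^ 2 =
      colNorm M j ^ 2 + if j = i then 2 * M a i * t + t ^ 2 else 0 := by
  rw [colNorm_sq, colNorm_sq]
  simp only [Pi.add_apply, Pi.smul_apply, unitMat_apply, smul_eq_mul]
  split_ifs with h
  · subst h
    have : 2 * M a j * t + t ^ 2 = ∑ b, if b = a then 2 * M b j * t + t ^ 2 else 0 := by simp
    rw [this, ← Finset.sum_add_distrib]
    refine Finset.sum_congr rfl fun b _ => ?_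
    by_cases hb : b = a
    · simp only [hb, and_self, if_true]; ring
    · simp [hb]
  · simp [h]

lemma colNorm_rpow_neg (M : Mat n p) (i : Fin p) (g : ℝ) :
    colNorm M i ^ (-g) = (colNorm M i ^ 2) ^ (-g / 2) := by
  rw [← Real.rpow_natCast_mul (colNorm_eq M i ▸ norm_nonneg _)]
  congr 1; push_cast; ring

lemma contDiff_colNorm_sq (i : Fin p) : ContDiff ℝ 2 fun M : Mat n p => colNorm M i ^ 2 := by
  simp_rw [colNorm_sq]
  fun_prop

lemma eventually_colNorm_pos {M : Mat n p} (hM : ∀ i, 0 < colNorm M i) :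
    ∀ᶠ θ in 𝓝 M, ∀ i, 0 < colNorm θ i := by
  refine eventually_all.2 fun i => ?_
  have hc : Continuous fun θ : Mat n p => colNorm θ i := by
    simp_rw [colNorm_eq]
    exact ((continuous_apply i).comp continuous_columns).norm
  exact hc.continuousAt.eventually_const_lt (hM i)

/-- The factor `∏ᵢ ‖M_{·i}‖^{-γᵢ}` of the prior. -/
noncomputable def colFactor (γ : Fin p → ℝ) (M : Mat n p) : ℝ := ∏ i, colNorm M i ^ (-(γ i))

lemma colFactor_pos (γ : Fin p → ℝ) {M : Mat n p} (hM : ∀ i, 0 < colNorm M i) :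
    0 < colFactor γ M := Finset.prod_pos fun i _ => Real.rpow_pos_of_pos (hM i) _

lemma contDiffAt_colFactor (γ : Fin p → ℝ) {M : Mat n p} (hM : ∀ i, 0 < colNorm M i) :
    ContDiffAt ℝ 2 (colFactor γ) M := by
  unfold colFactor
  refine contDiffAt_prod fun i _ => ?_
  simp_rw [colNorm_rpow_neg]
  exact (contDiff_colNorm_sq i).contDiffAt.rpow_const_of_ne (pow_pos (hM i) 2).ne'

/-- The logarithmic derivative of the factor `∏ᵢ ‖M_{·i}‖^{-γᵢ}`. -/
noncomputable def colSlope (γ : Fin p → ℝ) (a : Fin n) (i : Fin p) (M : Mat n p) : ℝ :=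
  -(γ i) * M a i / colNorm M i ^ 2

lemma partialDeriv_colFactor (γ : Fin p → ℝ) {M : Mat n p} (hM : ∀ i, 0 < colNorm M i) (a : Fin n)
    (i : Fin p) : partialDeriv (colFactor γ) a i M = colFactor γ M * colSlope γ a i M := by
  refine partialDeriv_eq_of_hasDerivAt ((contDiffAt_colFactor γ hM).differentiableAt two_ne_zero) ?_
  set q : ℝ → ℝ := fun t => colNorm M i ^ 2 + (2 * M a i * t + t ^ 2) with hq
  have hq0 : q 0 = colNorm M i ^ 2 := by simp [hq]
  have h1 : HasDerivAt q (2 * M a i) 0 := by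
    have := (((hasDerivAt_id (0 : ℝ)).const_mul (2 * M a i)).add
      ((hasDerivAt_id (0 : ℝ)).pow 2)).const_add (colNorm M i ^ 2)
    simpa [hq] using! this
  have h2 : HasDerivAt (fun t => q t ^ (-(γ i) / 2)) _ 0 :=
    h1.rpow_const (p := -(γ i) / 2) (Or.inl (by rw [hq0]; exact (pow_pos (hM i) 2).ne'))
  have h3 := h2.const_mul (∏ j ∈ Finset.univ.erase i, colNorm M j ^ (-(γ j)))
  -- only the `i`-th factor varies along the line
  have hfun : (fun t : ℝ => colFactor γ (M + t • unitMat a i)) = fun t =>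
      (∏ j ∈ Finset.univ.erase i, colNorm M j ^ (-(γ j))) * q t ^ (-(γ i) / 2) := by
    ext t
    rw [colFactor, ← Finset.prod_erase_mul _ _ (Finset.mem_univ i), colNorm_rpow_neg _ i,
      colNorm_sq_add_smul, if_pos rfl]
    congr 1
    refine Finset.prod_congr rfl fun j hj => ?_
    rw [colNorm_rpow_neg, colNorm_sq_add_smul, if_neg (Finset.ne_of_mem_erase hj), add_zero,
      ← colNorm_rpow_neg]
  rw [hfun]
  refine h3.congr_deriv (Eq.symm ?_)
  rw [colFactor, ← Finset.prod_erase_mul _ _ (Finset.mem_univ i), hq0, colSlope,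
    Real.rpow_sub_one (pow_pos (hM i) 2).ne', ← colNorm_rpow_neg]
  ring

lemma partialDeriv_colSlope (γ : Fin p → ℝ) {M : Mat n p} (hM : ∀ i, 0 < colNorm M i) (a : Fin n)
    (i : Fin p) : partialDeriv (colSlope γ a i) a i M =
      -(γ i) * (colNorm M i ^ 2)⁻¹ + 2 * γ i * M a i ^ 2 * ((colNorm M i ^ 2)⁻¹) ^ 2 := by
  have hr := (pow_pos (hM i) 2).ne'
  have hd : DifferentiableAt ℝ (colSlope γ a i) M := by
    have h1 := (contDiff_colNorm_sq (n := n) i).contDiffAt (x := M)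
    have h2 : ContDiffAt ℝ 2 (fun M : Mat n p => -(γ i) * M a i) M := by fun_prop
    exact (h2.div h1 hr).differentiableAt two_ne_zero
  refine partialDeriv_eq_of_hasDerivAt hd ?_
  have h1 : HasDerivAt (fun t : ℝ => colNorm M i ^ 2 + (2 * M a i * t + t ^ 2)) (2 * M a i) 0 := by
    have := (((hasDerivAt_id (0 : ℝ)).const_mul (2 * M a i)).add
      ((hasDerivAt_id (0 : ℝ)).pow 2)).const_add (colNorm M i ^ 2)
    simpa using! this
  have h2 : HasDerivAt (fun t : ℝ => -(γ i) * (M a i + t)) (-(γ i)) 0 := by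
    simpa using ((hasDerivAt_id (0 : ℝ)).const_add (M a i)).const_mul (-(γ i))
  have h3 := h2.div h1 (by simpa using hr)
  have hfun : (fun t : ℝ => colSlope γ a i (M + t • unitMat a i)) =
      (fun t : ℝ => -(γ i) * (M a i + t)) /
        fun t : ℝ => colNorm M i ^ 2 + (2 * M a i * t + t ^ 2) := by
    ext t
    rw [colSlope, colNorm_sq_add_smul, if_pos rfl]
    simp [unitMat_apply]
  rw [hfun]
  refine h3.congr_deriv (Eq.symm ?_)
  simp only [mul_zero, add_zero, ne_eq, OfNat.ofNat_ne_zero, not_false_eq_true, zero_pow]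
  field_simp
  ring

lemma riskLimit_colFactor (γ : Fin p → ℝ) {M : Mat n p} (hM : ∀ i, 0 < colNorm M i) :
    riskLimit (colFactor γ) M =
      ∑ i, (γ i ^ 2 - 2 * γ i * (n - 2)) * (colNorm M i ^ 2)⁻¹ := by
  have hu := (colFactor_pos γ hM).ne'
  have hterm : ∀ a i, 2 * partialDeriv (partialDeriv (colFactor γ) a i) a i M / colFactor γ M -
      (partialDeriv (colFactor γ) a i M / colFactor γ M) ^ 2 =
      (γ i ^ 2 + 4 * γ i) * ((colNorm M i ^ 2)⁻¹) ^ 2 * M a i ^ 2 -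
        2 * γ i * (colNorm M i ^ 2)⁻¹ := fun a i => by
    have hev : partialDeriv (colFactor γ) a i =ᶠ[𝓝 M] colFactor γ * colSlope γ a i := by
      filter_upwards [eventually_colNorm_pos hM] with θ hθ using partialDeriv_colFactor γ hθ a i
    have hr := (pow_pos (hM i) 2).ne'
    have hd : DifferentiableAt ℝ (colSlope γ a i) M := by
      have h1 := (contDiff_colNorm_sq (n := n) i).contDiffAt (x := M)
      have h2 : ContDiffAt ℝ 2 (fun M : Mat n p => -(γ i) * M a i) M := by fun_prop
      exact (h2.div h1 hr).differentiableAt two_ne_zero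
    rw [(partialDeriv_congr hev a i).eq_of_nhds, partialDeriv_mul
      ((contDiffAt_colFactor γ hM).differentiableAt two_ne_zero) hd,
      partialDeriv_colFactor γ hM, partialDeriv_colSlope γ hM, colSlope]
    field_simp
    ring
  unfold riskLimit
  rw [Finset.sum_comm]
  refine Finset.sum_congr rfl fun i _ => ?_
  simp_rw [hterm]
  rw [Finset.sum_sub_distrib, ← Finset.mul_sum, ← colNorm_sq]
  have hr := (hM i).ne'
  simp only [Finset.sum_const, Finset.card_univ, Fintype.card_fin, nsmul_eq_mul]
  field_simp
  ring

lemma det_gram_pos_of_mem_fullRank {M : Mat n p} (hM : M ∈ fullRank n p) :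
    0 < (Matrix.gram ℝ (columns n p M)).det := by
  refine lt_of_le_of_ne (det_gram_nonneg _) (Ne.symm ?_)
  rw [gram_columns, ← isUnit_iff_ne_zero, ← Matrix.isUnit_iff_isUnit_det,
    ← Matrix.linearIndependent_cols_iff_isUnit, linearIndependent_iff_card_eq_finrank_span,
    Fintype.card_fin]
  have h : (Matrix.of M).rank = p := hM
  rw [← Matrix.rank_transpose_mul_self, Matrix.rank_eq_finrank_span_cols] at h
  exact h.symm

lemma contDiff_det_gram : ContDiff ℝ 2 fun M : Mat n p => (Matrix.gram ℝ (columns n p M)).det := by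
  simp_rw [gram_columns, Matrix.det_apply, Matrix.mul_apply, Matrix.transpose_apply,
    Matrix.of_apply]
  refine ContDiff.sum fun σ _ => ContDiff.const_smul _ ?_
  refine contDiff_prod fun i _ => ContDiff.sum fun a _ => ?_
  fun_prop

lemma contDiffAt_priorSVS {M : Mat n p} (hM : 0 < (Matrix.gram ℝ (columns n p M)).det) :
    ContDiffAt ℝ 2 (priorSVS (n := n) (p := p)) M := by
  simp_rw [funext (priorSVS_eq (n := n) (p := p))]
  exact contDiff_det_gram.contDiffAt.rpow_const_of_ne hM.ne'

lemma priorSVS_pos {M : Mat n p} (hM : 0 < (Matrix.gram ℝ (columns n p M)).det) :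
    0 < priorSVS M := by
  rw [priorSVS_eq]
  exact Real.rpow_pos_of_pos hM _

/-- The matrix with the `i`-th column of `M` and zeros elsewhere. -/
def colPart (M : Mat n p) (i : Fin p) : Mat n p := fun a j => if j = i then M a i else 0

lemma sum_smul_unitMat_col (M : Mat n p) (i : Fin p) :
    ∑ a, M a i • unitMat a i = colPart M i := by
  ext b j
  simp only [Finset.sum_apply, Pi.smul_apply, unitMat_apply, smul_eq_mul, mul_ite, mul_one,
    mul_zero, colPart]
  rw [Finset.sum_eq_single b (by intro c _ hc; simp [hc.symm]) (by simp)]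
  simp

lemma det_gram_add_smul_colPart (M : Mat n p) (i : Fin p) (t : ℝ) :
    (Matrix.gram ℝ (columns n p (M + t • colPart M i))).det =
      (1 + t) ^ 2 * (Matrix.gram ℝ (columns n p M)).det := by
  set d : Fin p → ℝ := fun j => if j = i then 1 + t else 1 with hd
  have h : Matrix.of (M + t • colPart M i) = Matrix.of M * Matrix.diagonal d := by
    ext a j
    rw [Matrix.mul_diagonal]
    simp only [Matrix.of_apply, Pi.add_apply, Pi.smul_apply, colPart, smul_eq_mul, hd]
    split_ifs with hj
    · subst hj; ring
    · ring
  have hdet : (Matrix.diagonal d).det = 1 + t := by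
    rw [Matrix.det_diagonal, hd, Finset.prod_ite_eq' Finset.univ i]
    simp
  rw [gram_columns, gram_columns, h, Matrix.transpose_mul, Matrix.diagonal_transpose,
    Matrix.mul_assoc, ← Matrix.mul_assoc _ _ (Matrix.diagonal d), Matrix.det_mul, Matrix.det_mul,
    hdet]
  ring

/-- Euler's relation for `π_SVS`, which is homogeneous of degree `-(n - p - 1)` in each column. -/
lemma sum_mul_partialDeriv_priorSVS {M : Mat n p}
    (hM : 0 < (Matrix.gram ℝ (columns n p M)).det) (i : Fin p) :
    ∑ a, M a i * partialDeriv priorSVS a i M = -((n : ℝ) - p - 1) * priorSVS M := by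
  have hd := (contDiffAt_priorSVS hM).differentiableAt two_ne_zero
  have h0 : ∑ a, M a i * partialDeriv priorSVS a i M = fderiv ℝ priorSVS M (colPart M i) := by
    rw [← sum_smul_unitMat_col, map_sum]
    simp only [map_smul, smul_eq_mul, partialDeriv]
  have h1 : HasDerivAt (fun t : ℝ => M + t • colPart M i) (colPart M i) 0 := by
    simpa using ((hasDerivAt_id (0 : ℝ)).smul_const (colPart M i)).const_add M
  have h2 : HasFDerivAt priorSVS (fderiv ℝ priorSVS M) (M + (0 : ℝ) • colPart M i) := by
    simpa using hd.hasFDerivAt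
  have h3 := h2.comp_hasDerivAt 0 h1
  have h4 : HasDerivAt (fun t : ℝ => ((1 + t) ^ 2) ^ (-(((n : ℝ) - p - 1) / 2)) * priorSVS M)
      (-((n : ℝ) - p - 1) * priorSVS M) 0 := by
    have e1 : HasDerivAt (fun t : ℝ => (1 + t) ^ 2) 2 0 := by
      simpa using! ((hasDerivAt_id (0 : ℝ)).const_add 1).pow 2
    have e2 := (e1.rpow_const (p := -(((n : ℝ) - p - 1) / 2)) (Or.inl (by simp))).mul_const
      (priorSVS M)
    refine e2.congr_deriv (Eq.symm ?_)
    simp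
    ring
  have h5 : (priorSVS ∘ fun t : ℝ => M + t • colPart M i) =
      fun t : ℝ => ((1 + t) ^ 2) ^ (-(((n : ℝ) - p - 1) / 2)) * priorSVS M := by
    ext t
    rw [Function.comp, priorSVS_eq, priorSVS_eq, det_gram_add_smul_colPart,
      Real.mul_rpow (by positivity) hM.le]
  rw [h5] at h3
  rw [h0]
  exact h3.unique h4

lemma riskLimit_priorMSVS2 (γ : Fin p → ℝ) {M : Mat n p} (hM : M ∈ fullRank n p) :
    riskLimit (priorMSVS2 γ) M - riskLimit priorSVS M =
      ∑ i, γ i * (γ i - 2 * p + 2) * (colNorm M i ^ 2)⁻¹ := by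
  have hdet := det_gram_pos_of_mem_fullRank hM
  have hcol := colNorm_pos hdet.ne'
  have h : priorMSVS2 (n := n) γ = priorSVS * colFactor γ := rfl
  have hπ := (priorSVS_pos hdet).ne'
  have hu := (colFactor_pos γ hcol).ne'
  have hcross : ∑ a, ∑ i, partialDeriv priorSVS a i M / priorSVS M *
      (partialDeriv (colFactor γ) a i M / colFactor γ M) =
      ∑ i, γ i * ((n : ℝ) - p - 1) * (colNorm M i ^ 2)⁻¹ := by
    rw [Finset.sum_comm]
    refine Finset.sum_congr rfl fun i _ => ?_
    have h1 : ∀ a, partialDeriv priorSVS a i M / priorSVS M *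
        (partialDeriv (colFactor γ) a i M / colFactor γ M) =
        -(γ i) * (colNorm M i ^ 2)⁻¹ * (priorSVS M)⁻¹ * (M a i * partialDeriv priorSVS a i M) :=
      fun a => by
        rw [partialDeriv_colFactor γ hcol, colSlope]
        field_simp
    simp_rw [h1]
    rw [← Finset.mul_sum, sum_mul_partialDeriv_priorSVS hdet]
    field_simp
  rw [h, riskLimit_mul (contDiffAt_priorSVS hdet) (contDiffAt_colFactor γ hcol) hπ hu, hcross,
    riskLimit_colFactor γ hcol, add_assoc, add_sub_cancel_left, Finset.mul_sum,
    ← Finset.sum_add_distrib]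
  refine Finset.sum_congr rfl fun i _ => ?_
  ring

lemma tendsto_scaledRiskDiff (hp : 1 ≤ p) (hn : p + 1 < n) {γ : Fin p → ℝ}
    (hγ : ∀ i, 0 ≤ γ i ∧ γ i ≤ p) {M : Mat n p} (hM : M ∈ fullRank n p) :
    Tendsto (scaledRiskDiff (genBayes (priorMSVS2 γ)) (genBayes priorSVS) M) atTop
      (𝓝 (∑ i, γ i * (γ i - 2 * p + 2) * (colNorm M i ^ 2)⁻¹)) := by
  have hdet := det_gram_pos_of_mem_fullRank hM
  have hcol := colNorm_pos hdet.ne'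
  have h1 := (tamePrior_priorMSVS2 hp hn hγ).tendsto_sq_mul_risk_sub (M := M)
    ((contDiffAt_priorSVS hdet).mul (contDiffAt_colFactor γ hcol))
    (mul_pos (priorSVS_pos hdet) (colFactor_pos γ hcol))
  have h2 := (tamePrior_priorSVS hp hn).tendsto_sq_mul_risk_sub (contDiffAt_priorSVS hdet)
    (priorSVS_pos hdet)
  rw [← riskLimit_priorMSVS2 γ hM]
  refine (h1.sub h2).congr fun N => ?_
  rw [scaledRiskDiff]
  ring

/-- Every term is nonpositive, as `γᵢ - 2p + 2 ≤ 2 - p`, and all of them vanish only if `p = 2` and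
`γᵢ = 2` for every `i`. -/
lemma sum_riskLimit_neg (hp : 2 ≤ p) {γ : Fin p → ℝ} (hγ : ∀ i, γ i ≤ p) (hpos : ∀ i, 0 < γ i)
    (hne : ¬(p = 2 ∧ ∀ i, γ i = 2)) {M : Mat n p} (hM : ∀ i, 0 < colNorm M i) :
    ∑ i, γ i * (γ i - 2 * p + 2) * (colNorm M i ^ 2)⁻¹ < 0 := by
  have hp2 : (2 : ℝ) ≤ p := by exact_mod_cast hp
  obtain ⟨j, hj⟩ : ∃ j, γ j - 2 * p + 2 < 0 := by
    by_contra! hcon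
    have hpe : (p : ℝ) = 2 := le_antisymm
      (by have h1 := hcon ⟨0, by omega⟩; have h2 := hγ ⟨0, by omega⟩; linarith) hp2
    refine hne ⟨by exact_mod_cast hpe, fun i => ?_⟩
    have h1 := hcon i
    have h2 := hγ i
    linarith
  have hinv : ∀ i, 0 < (colNorm M i ^ 2)⁻¹ := fun i => inv_pos.2 (pow_pos (hM i) 2)
  refine Finset.sum_neg' (fun i _ => ?_) ⟨j, Finset.mem_univ j, ?_⟩
  · refine mul_nonpos_of_nonpos_of_nonneg (mul_nonpos_of_nonneg_of_nonpos (hpos i).le ?_)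
      (hinv i).le
    have := hγ i
    linarith
  · exact mul_neg_of_neg_of_pos (mul_neg_of_pos_of_neg (hpos j) hj) (hinv j)

end ShrinkagePriors

open ShrinkagePriors
theorem theorem5 (n p : ℕ) (hp : 1 ≤ p) (hn : p + 1 < n) (γ : Fin p → ℝ)
    (hγ : ∀ i, 0 ≤ γ i ∧ γ i ≤ p) :
    (∀ N : ℕ, 1 ≤ N →
      PosteriorMeanExists (priorSVS (n := n) (p := p)) N ∧
      PosteriorMeanExists (priorMSVS2 (n := n) γ) N ∧
      ∀ M : Mat n p,
        FiniteRisk N (genBayes priorSVS N) M ∧ FiniteRisk N (genBayes (priorMSVS2 γ) N) M) ∧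
    (∀ M ∈ fullRank n p,
      Tendsto (scaledRiskDiff (genBayes (priorMSVS2 γ)) (genBayes priorSVS) M) atTop
        (𝓝 (∑ i, γ i * (γ i - 2 * p + 2) * (colNorm M i ^ 2)⁻¹))) ∧
    (2 ≤ p → (∀ i, 0 < γ i) → ¬(p = 2 ∧ ∀ i, γ i = 2) →
      AsymptoticallyDominates (genBayes (priorMSVS2 γ)) (genBayes priorSVS) (fullRank n p)) := by
  have h1 := tamePrior_priorSVS hp hn
  have h2 := tamePrior_priorMSVS2 hp hn hγ
  refine ⟨fun N hN => ⟨h1.posteriorMeanExists hN, h2.posteriorMeanExists hN, fun M =>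
    ⟨h1.finiteRisk hN M, h2.finiteRisk hN M⟩⟩, fun M hM => tendsto_scaledRiskDiff hp hn hγ hM,
    fun hp2 hpos hne M hM => ⟨_, ?_, tendsto_scaledRiskDiff hp hn hγ hM⟩⟩
  exact sum_riskLimit_neg hp2 (fun i => (hγ i).2) hpos hne
    (colNorm_pos (det_gram_pos_of_mem_fullRank hM).ne')
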